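/- Let $\tau(n)$ denote the number of positive divisors of $n$, let $[n_1,\dots,n_r]$ denote the least common multiple, and let $n_1,\dots,n_r$ run over positive integers. Call a real number $\theta$ an admissible exponent in Dirichlet's divisor problem if, for every $\varepsilon>0$, $$\sum_{n\le x}\tau(n)=x\log x+(2\gamma-1)x+O(x^{\theta+\varepsilon})\qquad(x\to\infty),$$ where $\gamma$ is Euler's constant. Let $r\ge 2$ be an integer. There are real polynomials $P_r$ and $Q_r$, both of degree $r$ (and depending only on $r$), such that for every admissible exponent $\theta$ and every $\varepsilon>0$, as $x\to\infty$, $$\sum_{n_1,\dots,n_r\le x}\tau(n_1\cdots n_r)=x^rP_r(\log x)+O(x^{r-1+\theta+\varepsilon}),$$ $$\sum_{n_1,\dots,n_r\le x}\tau([n_1,\dots,n_r])=x^rQ_r(\log x)+O(x^{r-1+\theta+\varepsilon}),$$ where the implied constants may depend on $r$, $\theta$ and $\varepsilon$. The leading coefficients of $P_r$ and $Q_r$ are, respectively, the products over all primes $$K_{P,r}=\prod_p\Bigl(1-\frac1p\Bigr)^{r-1}\Bigl(1+\frac{r-1}{p}\Bigr)$$ and $$K_{Q,r}=\prod_p\Bigl(1-\frac1p\Bigr)^{2r}\sum_{\nu_1,\dots,\nu_r=0}^{\infty}\frac{\max(\nu_1,\dots,\nu_r)+1}{p^{\nu_1+\cdots+\nu_r}},$$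 where the products and the inner series converge unconditionally. -/

import Mathlib

open Filter Asymptotics

/-- The number `τ(n)` of positive divisors of `n`. -/
def divisorCount (n : ℕ) : ℕ := n.divisors.card

/-- `∑_{n ≤ x} τ(n)`, over positive integers `n`. -/
noncomputable def divisorSum (x : ℝ) : ℝ :=
  ∑ n ∈ Finset.Icc 1 ⌊x⌋₊, (divisorCount n : ℝ)

/-- `θ` is an admissible exponent in the Dirichlet divisor problem:
`∑_{n ≤ x} τ(n) = x log x + (2γ - 1) x + O(x ^ (θ + ε))` for every `ε > 0`. -/
def IsDivisorExponent (θ : ℝ) : Prop :=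
  ∀ ε : ℝ, 0 < ε →
    (fun x : ℝ => divisorSum x -
        (x * Real.log x + (2 * Real.eulerMascheroniConstant - 1) * x))
      =O[atTop] fun x : ℝ => x ^ (θ + ε)

/-- The `r`-tuples of positive integers `n₁, …, n_r ≤ x`. -/
noncomputable def tuplesUpTo (r : ℕ) (x : ℝ) : Finset (Fin r → ℕ) :=
  Fintype.piFinset fun _ => Finset.Icc 1 ⌊x⌋₊

/-- `∑_{n₁, …, n_r ≤ x} τ(n₁ ⋯ n_r)`. -/
noncomputable def divisorSumProd (r : ℕ) (x : ℝ) : ℝ :=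
  ∑ n ∈ tuplesUpTo r x, (divisorCount (∏ i, n i) : ℝ)

/-- `∑_{n₁, …, n_r ≤ x} τ([n₁, …, n_r])`, with the least common multiple. -/
noncomputable def divisorSumLcm (r : ℕ) (x : ℝ) : ℝ :=
  ∑ n ∈ tuplesUpTo r x, (divisorCount (Finset.univ.lcm n) : ℝ)

/-- The factor at `p` of the Euler product `K_{P,r}`. -/
noncomputable def eulerFactorP (r : ℕ) (p : ℕ) : ℝ :=
  (1 - 1 / (p : ℝ)) ^ (r - 1) * (1 + ((r : ℝ) - 1) / (p : ℝ))

/-- The term `(max(ν₁, …, ν_r) + 1) / p ^ (ν₁ + ⋯ + ν_r)`. -/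
noncomputable def maxTerm (r : ℕ) (p : ℕ) (ν : Fin r → ℕ) : ℝ :=
  (((Finset.univ.sup ν : ℕ) : ℝ) + 1) / (p : ℝ) ^ (∑ i, ν i)

/-- The factor at `p` of the Euler product `K_{Q,r}`. -/
noncomputable def eulerFactorQ (r : ℕ) (p : ℕ) : ℝ :=
  (1 - 1 / (p : ℝ)) ^ (2 * r) * ∑' ν : Fin r → ℕ, maxTerm r p ν

/-! Both summands are multiplicative functions `f` of tuples that agree with `τ` when only one entry
is different from 1 (`IsDivisorLike`). Write `f` as the coordinatewise Dirichlet convolution of `h =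
sieved f` with `τ ⊗ ⋯ ⊗ τ`. Summing over the box gives `∑ f(n) = ∑_d h(d) ∏ D(x / d_i)`, with `D`
the summatory function of `τ` (`sum_tuplesUpTo_eq_tsum`).

The point is that `h` is sparse: at a prime it vanishes whenever exactly one exponent is nonzero
(`IsDivisorLike.sievedPow_single`). Every nontrivial local term thus involves two coordinates, and
an Euler product argument shows that `∑ |h(d)| ∏ d_i ^ (-σ_i)` converges once all `σ_i > 0` and `σ_i
+ σ_j ≥ κ > 1` for `i ≠ j` (`IsDivisorLike.summable_sieved`).

Replacing each `D(x / d_i)` by its main term and expanding in `log x` gives the polynomial `mainPoly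
f`; its top coefficient is `∑ h(d) / (d_1 ⋯ d_r)`, an Euler product that does not vanish. Replacing
the factors one at a time costs the divisor-problem error in one coordinate and `x ^ (1 + δ)` in
each of the others. The resulting series has weight `σ` in one coordinate and `1 - δ` elsewhere,
with `δ < σ`, so it converges (`IsDivisorLike.isBigO_sum_sub`). -/

/-! ### Dirichlet convolution of functions of tuples. -/

section TupleConvolution

variable {ι : Type*} [Fintype ι] [DecidableEq ι]

/-- A function of tuples is multiplicative if it is multiplicative on pairs of tuples all of whose
entries are mutually coprime. -/
def IsTupleMultiplicative (k : (ι → ℕ) → ℝ) : Prop :=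
  k 1 = 1 ∧ ∀ a b : ι → ℕ, (∀ i j, (a i).Coprime (b j)) → k (a * b) = k a * k b

/-- Tuples of divisors. -/
def tupleDivisors (n : ι → ℕ) : Finset (ι → ℕ) := Fintype.piFinset fun i => (n i).divisors

/-- Coordinatewise Dirichlet convolution of functions of tuples. -/
def tupleConv (f g : (ι → ℕ) → ℝ) (n : ι → ℕ) : ℝ := ∑ a ∈ tupleDivisors n, f a * g (n / a)

lemma mem_tupleDivisors {n a : ι → ℕ} : a ∈ tupleDivisors n ↔ ∀ i, a i ∣ n i ∧ n i ≠ 0 := by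
  simp [tupleDivisors]

lemma tupleDivisors_eq_empty {n : ι → ℕ} (h : ∃ i, n i = 0) : tupleDivisors n = ∅ := by
  obtain ⟨i, hi⟩ := h
  ext a
  simp only [mem_tupleDivisors, Finset.notMem_empty, iff_false]
  exact fun h => (h i).2 hi

/-- Coordinatewise, a divisor `x` of `m * n` is recovered from `gcd(x, m)` and `gcd(x, n)`. -/
lemma sum_tupleDivisors_mul {M : Type*} [AddCommMonoid M] (m n : ι → ℕ)
    (h : ∀ i, (m i).Coprime (n i)) (g : (ι → ℕ) → M) :
    ∑ x ∈ tupleDivisors (m * n), g x =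
      ∑ d ∈ tupleDivisors m, ∑ e ∈ tupleDivisors n, g (d * e) := by
  rw [← Finset.sum_product']
  refine Finset.sum_nbij' (fun x => (fun i => (x i).gcd (m i), fun i => (x i).gcd (n i)))
    (fun y => y.1 * y.2) ?_ ?_ ?_ ?_ ?_
  · intro x hx
    rw [mem_tupleDivisors] at hx
    simp only [Finset.mem_product, mem_tupleDivisors]
    refine ⟨fun i => ⟨Nat.gcd_dvd_right _ _, ?_⟩, fun i => ⟨Nat.gcd_dvd_right _ _, ?_⟩⟩
    · exact left_ne_zero_of_mul (hx i).2
    · exact right_ne_zero_of_mul (hx i).2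
  · rintro ⟨d, e⟩ hy
    simp only [Finset.mem_product, mem_tupleDivisors] at hy ⊢
    exact fun i => ⟨mul_dvd_mul (hy.1 i).1 (hy.2 i).1, mul_ne_zero (hy.1 i).2 (hy.2 i).2⟩
  · intro x hx
    rw [mem_tupleDivisors] at hx
    ext i
    simp only [Pi.mul_apply]
    rw [← (h i).gcd_mul]
    exact Nat.gcd_eq_left (hx i).1
  · rintro ⟨d, e⟩ hy
    simp only [Finset.mem_product, mem_tupleDivisors] at hy
    ext i
    · simp only [Pi.mul_apply]
      rw [(Nat.Coprime.coprime_dvd_left (hy.2 i).1 (h i).symm).gcd_mul_right_cancel]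
      exact Nat.gcd_eq_left (hy.1 i).1
    · simp only [Pi.mul_apply]
      rw [(Nat.Coprime.coprime_dvd_left (hy.1 i).1 (h i)).gcd_mul_left_cancel]
      exact Nat.gcd_eq_left (hy.2 i).1
  · intro x hx
    rw [mem_tupleDivisors] at hx
    congr 1
    ext i
    simp only [Pi.mul_apply]
    rw [← (h i).gcd_mul]
    exact (Nat.gcd_eq_left (hx i).1).symm

lemma IsTupleMultiplicative.tupleConv {f g : (ι → ℕ) → ℝ} (hf : IsTupleMultiplicative f)
    (hg : IsTupleMultiplicative g) : IsTupleMultiplicative (tupleConv f g) := by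
  constructor
  · have h : tupleDivisors (1 : ι → ℕ) = {1} := by
      ext a
      simp [mem_tupleDivisors, funext_iff]
    have h1 : (1 : ι → ℕ) / 1 = 1 := by ext; simp
    simp [_root_.tupleConv, h, hf.1, h1, hg.1]
  · intro m n hmn
    rw [_root_.tupleConv, sum_tupleDivisors_mul m n fun i => hmn i i, _root_.tupleConv,
      _root_.tupleConv, Finset.sum_mul_sum]
    refine Finset.sum_congr rfl fun d hd => Finset.sum_congr rfl fun e he => ?_
    rw [mem_tupleDivisors] at hd he
    have h1 : m * n / (d * e) = m / d * (n / e) := by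
      ext i
      exact (Nat.div_mul_div_comm (hd i).1 (he i).1).symm
    rw [h1, hf.2 d e, hg.2 (m / d) (n / e)]
    · ring
    · intro i j
      exact Nat.Coprime.of_dvd (Nat.div_dvd_of_dvd (hd i).1) (Nat.div_dvd_of_dvd (he j).1) (hmn i j)
    · intro i j
      exact Nat.Coprime.of_dvd (hd i).1 (he j).1 (hmn i j)

/-- The associativity of convolution, in the form of the substitution `d = a * b` in chains `a ∣ d ∣
n`. -/
lemma sum_tupleDivisors_assoc {M : Type*} [AddCommMonoid M] (n : ι → ℕ)
    (F : (ι → ℕ) → (ι → ℕ) → (ι → ℕ) → M) :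
    ∑ d ∈ tupleDivisors n, ∑ a ∈ tupleDivisors d, F a (d / a) (n / d) =
      ∑ a ∈ tupleDivisors n, ∑ b ∈ tupleDivisors (n / a), F a b (n / a / b) := by
  rw [Finset.sum_sigma', Finset.sum_sigma']
  refine Finset.sum_bij' (fun x _ => ⟨x.2, x.1 / x.2⟩) (fun y _ => ⟨y.1 * y.2, y.1⟩) ?_ ?_ ?_ ?_ ?_
  · rintro ⟨d, a⟩ hx
    simp only [Finset.mem_sigma, mem_tupleDivisors] at hx ⊢
    refine ⟨fun i => ⟨(hx.2 i).1.trans (hx.1 i).1, (hx.1 i).2⟩, fun i => ⟨?_, ?_⟩⟩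
    · exact Nat.div_dvd_div (hx.2 i).1 (hx.1 i).1
    · exact (Nat.div_pos (Nat.le_of_dvd (Nat.pos_of_ne_zero (hx.1 i).2)
        ((hx.2 i).1.trans (hx.1 i).1)) (Nat.pos_of_dvd_of_pos (hx.2 i).1
        (Nat.pos_of_ne_zero (hx.2 i).2))).ne'
  · rintro ⟨a, b⟩ hy
    simp only [Finset.mem_sigma, mem_tupleDivisors] at hy ⊢
    refine ⟨fun i => ⟨?_, (hy.1 i).2⟩, fun i => ⟨dvd_mul_right _ _, ?_⟩⟩
    · exact (Nat.dvd_div_iff_mul_dvd (hy.1 i).1).1 (hy.2 i).1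
    · exact ne_zero_of_dvd_ne_zero (hy.1 i).2
        ((Nat.dvd_div_iff_mul_dvd (hy.1 i).1).1 (hy.2 i).1)
  · rintro ⟨d, a⟩ hx
    simp only [Finset.mem_sigma, mem_tupleDivisors] at hx
    have : a * (d / a) = d := by
      ext i
      exact Nat.mul_div_cancel' (hx.2 i).1
    simp [this]
  · rintro ⟨a, b⟩ hy
    simp only [Finset.mem_sigma, mem_tupleDivisors] at hy
    have : a * b / a = b := by
      ext i
      exact Nat.mul_div_cancel_left _ (Nat.pos_of_ne_zero
        (ne_zero_of_dvd_ne_zero (hy.1 i).2 (hy.1 i).1))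
    simp [this]
  · rintro ⟨d, a⟩ hx
    simp only [Finset.mem_sigma, mem_tupleDivisors] at hx
    have : n / a / (d / a) = n / d := by
      ext i
      simp only [Pi.div_apply]
      rw [Nat.div_div_eq_div_mul, Nat.mul_div_cancel' (hx.2 i).1]
    simp [this]

/-- Convolution inverse relation in each coordinate. -/
lemma tupleConv_tupleConv_prod {m t : ArithmeticFunction ℝ} (hmt : m * t = 1)
    (f : (ι → ℕ) → ℝ) {n : ι → ℕ} (hn : ∀ i, n i ≠ 0) :
    tupleConv (tupleConv f fun b => ∏ i, m (b i)) (fun b => ∏ i, t (b i)) n = f n := by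
  have h1 : ∀ k : ℕ, ∑ b ∈ k.divisors, m b * t (k / b) = if k = 1 then 1 else 0 := by
    intro k
    rw [← Nat.sum_divisorsAntidiagonal (f := fun a b => m a * t b), ← ArithmeticFunction.mul_apply,
      hmt, ArithmeticFunction.one_apply]
  unfold tupleConv
  simp_rw [Finset.sum_mul]
  rw [sum_tupleDivisors_assoc n
    (fun a b c => f a * (∏ i, m (b i)) * ∏ i, t (c i))]
  -- The inner sum factors over the coordinates into values of `m * t = 1` at `n i / a i`, so only
  -- `a = n` survives.
  have h2 : ∀ a ∈ tupleDivisors n, ∑ b ∈ tupleDivisors (n / a),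
      f a * (∏ i, m (b i)) * ∏ i, t ((n / a / b) i) = if a = n then f n else 0 := by
    intro a ha
    rw [mem_tupleDivisors] at ha
    simp_rw [mul_assoc, ← Finset.mul_sum, ← Finset.prod_mul_distrib]
    have := Finset.prod_univ_sum (fun i => ((n / a) i).divisors)
      (fun i b => m b * t ((n / a) i / b))
    rw [tupleDivisors]
    simp only [Pi.div_apply] at this ⊢
    rw [← this]
    simp_rw [h1]
    split_ifs with h
    · subst h
      rw [Finset.prod_eq_one, mul_one]
      intro i _
      rw [if_pos (Nat.div_self (Nat.pos_of_ne_zero (hn i)))]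
    · obtain ⟨i, hi⟩ := Function.ne_iff.1 h
      rw [Finset.prod_eq_zero (Finset.mem_univ i), mul_zero]
      rw [if_neg]
      intro h3
      apply hi
      have := Nat.mul_div_cancel' (ha i).1
      rw [h3, mul_one] at this
      exact this
  rw [Finset.sum_congr rfl h2, Finset.sum_ite_eq', if_pos]
  rw [mem_tupleDivisors]
  exact fun i => ⟨dvd_rfl, hn i⟩

omit [DecidableEq ι] in
lemma isTupleMultiplicative_prod {m : ArithmeticFunction ℝ} (hm : m.IsMultiplicative) :
    IsTupleMultiplicative fun b : ι → ℕ => ∏ i, m (b i) := by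
  constructor
  · simp [hm.1]
  · intro a b hab
    rw [← Finset.prod_mul_distrib]
    exact Finset.prod_congr rfl fun i _ => hm.2 (hab i i)

/-- Tuples of powers of a fixed number. -/
def powTuple (p : ℕ) (ν : ι → ℕ) : ι → ℕ := fun i => p ^ ν i

omit [Fintype ι] [DecidableEq ι] in
lemma powTuple_injective {p : ℕ} (hp : p.Prime) :
    Function.Injective (powTuple p : (ι → ℕ) → ι → ℕ) := by
  intro a b h
  ext i
  exact Nat.pow_right_injective hp.two_le (congrFun h i)

lemma tupleConv_powTuple (f g : (ι → ℕ) → ℝ) {p : ℕ} (hp : p.Prime) (ν : ι → ℕ) :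
    tupleConv f g (powTuple p ν) =
      ∑ a ∈ Finset.Iic ν, f (powTuple p a) * g (powTuple p (ν - a)) := by
  unfold tupleConv
  symm
  refine Finset.sum_bij (fun a _ => powTuple p a) ?_ ?_ ?_ ?_
  · intro a ha
    rw [Finset.mem_Iic] at ha
    rw [mem_tupleDivisors]
    exact fun i => ⟨pow_dvd_pow _ (ha i), pow_ne_zero _ hp.ne_zero⟩
  · intro a _ b _ h
    exact powTuple_injective hp h
  · intro b hb
    rw [mem_tupleDivisors] at hb
    choose a ha using fun i => (Nat.dvd_prime_pow hp).1 (hb i).1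
    exact ⟨a, Finset.mem_Iic.2 fun i => (ha i).1, funext fun i => (ha i).2.symm⟩
  · intro a ha
    rw [Finset.mem_Iic] at ha
    congr 2
    ext i
    exact (Nat.pow_div (ha i) hp.pos).symm

end TupleConvolution

/-! ### Multiple series of products. -/

section ProductSums

lemma summable_norm_prod_and_tsum_prod {n : ℕ} (a : Fin n → ℕ → ℝ)
    (ha : ∀ i, Summable fun k => ‖a i k‖) :
    (Summable fun ν : Fin n → ℕ => ‖∏ i, a i (ν i)‖) ∧
      ∑' ν : Fin n → ℕ, ∏ i, a i (ν i) = ∏ i, ∑' k, a i k := by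
  induction n with
  | zero => exact ⟨(hasSum_fintype _).summable, by simp⟩
  | succ n ih =>
    obtain ⟨h1, h2⟩ := ih (fun i => a i.succ) fun i => ha i.succ
    let e := Fin.consEquiv (fun _ : Fin (n + 1) => ℕ)
    have key : ∀ y : ℕ × (Fin n → ℕ), ∏ i, a i (e y i) = a 0 y.1 * ∏ i, a i.succ (y.2 i) := by
      intro y
      rw [Fin.prod_univ_succ]
      simp [e, Fin.consEquiv]
    constructor
    · rw [← e.summable_iff]
      simpa only [Function.comp_def, key] using Summable.mul_norm (ha 0) h1
    · rw [← e.tsum_eq]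
      simp only [key]
      rw [Fin.prod_univ_succ, ← h2]
      exact (tsum_mul_tsum_of_summable_norm (ha 0) h1).symm

end ProductSums

/-! ### Euler products for series over tuples, by grouping tuples according to their product. -/

section EulerProduct

variable {ι : Type*} [Fintype ι] [DecidableEq ι]

/-- The sum of `k` over all tuples with product `n`. -/
def sumOfProdEq (k : (ι → ℕ) → ℝ) (n : ℕ) : ℝ :=
  ∑ d ∈ tupleDivisors (fun _ => n) with ∏ i, d i = n, k d

lemma sumOfProdEq_one {k : (ι → ℕ) → ℝ} (hk : IsTupleMultiplicative k) : sumOfProdEq k 1 = 1 := by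
  have h : {d ∈ tupleDivisors (fun _ : ι => 1) | ∏ i, d i = 1} = {1} := by
    ext a
    simp only [Finset.mem_filter, mem_tupleDivisors, Finset.mem_singleton, funext_iff]
    simp +contextual
  rw [sumOfProdEq, h, Finset.sum_singleton, hk.1]

/-- This makes the grouped sums an ordinary multiplicative function of one variable, to which the
classical Euler product applies. By coprimality, a factorization of `m * n` splits uniquely into one
of `m` and one of `n`. -/
lemma sumOfProdEq_mul {k : (ι → ℕ) → ℝ} (hk : IsTupleMultiplicative k) {m n : ℕ}
    (h : m.Coprime n) : sumOfProdEq k (m * n) = sumOfProdEq k m * sumOfProdEq k n := by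
  unfold sumOfProdEq
  rw [Finset.sum_filter, Finset.sum_filter, Finset.sum_filter, Finset.sum_mul_sum]
  have := sum_tupleDivisors_mul (fun _ : ι => m) (fun _ => n) (fun _ => h)
    (fun d => if ∏ i, d i = m * n then k d else 0)
  simp only [Pi.mul_def] at this
  rw [this]
  refine Finset.sum_congr rfl fun d hd => Finset.sum_congr rfl fun e he => ?_
  rw [mem_tupleDivisors] at hd he
  have hk2 : k (fun i => d i * e i) = k d * k e :=
    hk.2 d e fun i j => Nat.Coprime.of_dvd (hd i).1 (he j).1 h
  rw [hk2, Finset.prod_mul_distrib]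
  have hdn : (∏ i, d i).Coprime n := Nat.Coprime.prod_left fun i _ => h.coprime_dvd_left (hd i).1
  have hem : m.Coprime (∏ i, e i) := Nat.Coprime.prod_right fun i _ => h.coprime_dvd_right (he i).1
  have hiff : (∏ i, d i) * ∏ i, e i = m * n ↔ ∏ i, d i = m ∧ ∏ i, e i = n := by
    constructor
    · intro heq
      have hde : (∏ i, d i).Coprime (∏ i, e i) :=
        Nat.Coprime.prod_left fun i _ => Nat.Coprime.prod_right fun j _ =>
          Nat.Coprime.of_dvd (hd i).1 (he j).1 h
      constructor
      · apply Nat.dvd_antisymm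
        · exact hdn.dvd_of_dvd_mul_right (heq ▸ dvd_mul_right _ _)
        · exact hem.dvd_of_dvd_mul_right (heq ▸ dvd_mul_right _ _)
      · apply Nat.dvd_antisymm
        · exact hem.symm.dvd_of_dvd_mul_left (heq ▸ dvd_mul_left _ _)
        · exact hdn.symm.dvd_of_dvd_mul_left (heq ▸ dvd_mul_left _ _)
    · rintro ⟨h1, h2⟩
      rw [h1, h2]
  simp only [hiff]
  by_cases h1 : ∏ i, d i = m <;> by_cases h2 : ∏ i, e i = n <;> simp only [h1, h2, and_self,
    and_false, false_and, if_true, if_false, mul_zero, zero_mul]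

/-- A fibre over `n ≠ 0` is finite. The fibre over `0` need not be, which is why `k` has to vanish
on tuples with a zero entry. -/
lemma tsum_fiber_prod {k : (ι → ℕ) → ℝ} (hk : ∀ d : ι → ℕ, (∃ i, d i = 0) → k d = 0) (n : ℕ) :
    ∑' d : (fun d : ι → ℕ => ∏ i, d i) ⁻¹' {n}, k d = sumOfProdEq k n := by
  rw [tsum_subtype ((fun d : ι → ℕ => ∏ i, d i) ⁻¹' {n}) k,
    tsum_eq_sum (s := {d ∈ tupleDivisors (fun _ : ι => n) | ∏ i, d i = n})]
  · refine Finset.sum_congr rfl fun d hd => ?_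
    rw [Finset.mem_filter] at hd
    exact Set.indicator_of_mem (by simpa using hd.2) _
  · intro d hd
    by_cases h : d ∈ (fun d : ι → ℕ => ∏ i, d i) ⁻¹' {n}
    · rw [Set.indicator_of_mem h]
      replace h : ∏ i, d i = n := h
      apply hk
      by_contra! hne
      apply hd
      rw [Finset.mem_filter, mem_tupleDivisors]
      refine ⟨fun i => ⟨h ▸ Finset.dvd_prod_of_mem d (Finset.mem_univ i), ?_⟩, h⟩
      rw [← h]
      exact Finset.prod_ne_zero_iff.2 fun i _ => hne i
    · exact Set.indicator_of_notMem h _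

lemma hasSum_sumOfProdEq {k : (ι → ℕ) → ℝ} (hk : ∀ d : ι → ℕ, (∃ i, d i = 0) → k d = 0)
    (hs : Summable k) : HasSum (sumOfProdEq k) (∑' d, k d) := by
  have h := hs.hasSum.tsum_fiberwise (fun d : ι → ℕ => ∏ i, d i)
  simpa only [tsum_fiber_prod hk] using h

lemma hasSum_sumOfProdEq_pow {k : (ι → ℕ) → ℝ} {p : ℕ} (hp : p.Prime)
    (hs : Summable fun ν => k (powTuple p ν)) :
    HasSum (fun e => sumOfProdEq k (p ^ e)) (∑' ν, k (powTuple p ν)) := by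
  have h := hs.hasSum.tsum_fiberwise (fun ν : ι → ℕ => ∑ i, ν i)
  suffices heq : ∀ e, sumOfProdEq k (p ^ e) =
      ∑' ν : (fun ν : ι → ℕ => ∑ i, ν i) ⁻¹' {e}, k (powTuple p ν) by
    simpa only [heq] using h
  intro e
  have hfin : ∀ x ∈ ({d ∈ tupleDivisors (fun _ : ι => p ^ e) | ∏ i, d i = p ^ e} : Finset _),
      ∃ ν : ι → ℕ, ∑ i, ν i = e ∧ powTuple p ν = x := by
    intro x hx
    rw [Finset.mem_filter, mem_tupleDivisors] at hx
    choose a ha using fun i => (Nat.dvd_prime_pow hp).1 (hx.1 i).1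
    refine ⟨a, Nat.pow_right_injective hp.two_le ?_, funext fun i => (ha i).2.symm⟩
    simp only
    rw [← hx.2, ← Finset.prod_pow_eq_pow_sum]
    exact Finset.prod_congr rfl fun i _ => (ha i).2.symm
  rw [tsum_subtype ((fun ν : ι → ℕ => ∑ i, ν i) ⁻¹' {e}) (fun ν => k (powTuple p ν)),
    tsum_eq_sum (s := {ν ∈ Fintype.piFinset fun _ : ι => Finset.range (e + 1) | ∑ i, ν i = e})]
  · symm
    refine Finset.sum_bij (fun ν _ => powTuple p ν) ?_ ?_ ?_ ?_
    · intro ν hν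
      simp only [Finset.mem_filter, Fintype.mem_piFinset, Finset.mem_range] at hν
      rw [Finset.mem_filter, mem_tupleDivisors]
      refine ⟨fun i => ⟨pow_dvd_pow _ (Nat.lt_succ_iff.1 (hν.1 i)), pow_ne_zero _ hp.ne_zero⟩, ?_⟩
      rw [← hν.2, ← Finset.prod_pow_eq_pow_sum]
      rfl
    · intro a _ b _ hab
      exact powTuple_injective hp hab
    · intro x hx
      obtain ⟨ν, h1, h2⟩ := hfin x hx
      refine ⟨ν, ?_, h2⟩
      simp only [Finset.mem_filter, Fintype.mem_piFinset, Finset.mem_range]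
      refine ⟨fun i => Nat.lt_succ_iff.2 ?_, h1⟩
      rw [← h1]
      exact Finset.single_le_sum (f := ν) (fun _ _ => Nat.zero_le _) (Finset.mem_univ i)
    · intro ν hν
      rw [Finset.mem_filter] at hν
      exact Set.indicator_of_mem (by simpa using hν.2) _
  · intro ν hν
    refine Set.indicator_of_notMem (fun h => hν ?_) _
    replace h : ∑ i, ν i = e := h
    simp only [Finset.mem_filter, Fintype.mem_piFinset, Finset.mem_range]
    refine ⟨fun i => Nat.lt_succ_iff.2 ?_, h⟩
    rw [← h]
    exact Finset.single_le_sum (f := ν) (fun _ _ => Nat.zero_le _) (Finset.mem_univ i)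

/-- A nonnegative multiplicative function is summable if its local sums are close to `1`. -/
lemma summable_of_multiplicative_of_nonneg {F : ℕ → ℝ} (h0 : ∀ n, 0 ≤ F n) (hF0 : F 0 = 0)
    (h1 : F 1 = 1)
    (hmul : ∀ {m n : ℕ}, m.Coprime n → F (m * n) = F m * F n)
    (hs : ∀ p : ℕ, p.Prime → Summable fun e => F (p ^ e))
    {c : ℕ → ℝ} (hc0 : ∀ n, 0 ≤ c n) (hc : Summable c)
    (hb : ∀ p : ℕ, p.Prime → ∑' e, F (p ^ e) ≤ 1 + c p) : Summable F := by
  refine summable_of_sum_range_le h0 (c := Real.exp (∑' n, c n)) fun N => ?_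
  obtain ⟨-, h⟩ := EulerProduct.summable_and_hasSum_smoothNumbers_prod_primesBelow_tsum h1 hmul
    (fun {p} hp => by simpa only [Real.norm_of_nonneg (h0 _)] using hs p hp) N
  -- Every positive `n < N` is `N`-smooth, so the partial sum is dominated by the finite Euler
  -- product.
  have h2 : ∑ n ∈ Finset.range N, F n ≤ ∏ p ∈ N.primesBelow, ∑' e, F (p ^ e) := by
    rw [← Finset.sum_filter_add_sum_filter_not (Finset.range N) (fun n => n ∈ N.smoothNumbers)]
    rw [Finset.sum_eq_zero (s := Finset.filter (fun n => n ∉ N.smoothNumbers) _), add_zero]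
    · rw [← Finset.sum_subtype_eq_sum_filter]
      exact sum_le_hasSum _ (fun _ _ => h0 _) h
    · intro n hn
      rw [Finset.mem_filter, Finset.mem_range] at hn
      rcases Nat.eq_zero_or_pos n with h3 | h3
      · rw [h3, hF0]
      · exact absurd (Nat.mem_smoothNumbers_of_lt h3 hn.1) hn.2
  refine h2.trans ?_
  calc ∏ p ∈ N.primesBelow, ∑' e, F (p ^ e) ≤ ∏ p ∈ N.primesBelow, Real.exp (c p) := by
        refine Finset.prod_le_prod (fun p _ => tsum_nonneg fun _ => h0 _) fun p hp => ?_
        refine (hb p (Nat.prime_of_mem_primesBelow hp)).trans ?_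
        rw [add_comm]
        exact Real.add_one_le_exp _
    _ = Real.exp (∑ p ∈ N.primesBelow, c p) := (Real.exp_sum _ _).symm
    _ ≤ Real.exp (∑' n, c n) := Real.exp_le_exp.2 (hc.sum_le_tsum _ fun n _ => hc0 n)

lemma sumOfProdEq_zero {k : (ι → ℕ) → ℝ} [Nonempty ι] : sumOfProdEq k 0 = 0 := by
  rw [sumOfProdEq, tupleDivisors_eq_empty ⟨Classical.arbitrary ι, rfl⟩]
  simp

lemma summable_of_tupleMultiplicative_of_nonneg [Nonempty ι] {k : (ι → ℕ) → ℝ}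
    (hk : IsTupleMultiplicative k)
    (hk0 : ∀ d : ι → ℕ, (∃ i, d i = 0) → k d = 0) (h0 : ∀ d, 0 ≤ k d)
    (hs : ∀ p : ℕ, p.Prime → Summable fun ν => k (powTuple p ν))
    {c : ℕ → ℝ} (hc0 : ∀ n, 0 ≤ c n) (hc : Summable c)
    (hb : ∀ p : ℕ, p.Prime → ∑' ν, k (powTuple p ν) ≤ 1 + c p) : Summable k := by
  have hF0 : ∀ n, 0 ≤ sumOfProdEq k n := fun n => Finset.sum_nonneg fun _ _ => h0 _
  have hF : Summable (sumOfProdEq k) := by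
    refine summable_of_multiplicative_of_nonneg hF0 sumOfProdEq_zero (sumOfProdEq_one hk)
      (sumOfProdEq_mul hk) (fun p hp => (hasSum_sumOfProdEq_pow hp (hs p hp)).summable) hc0 hc ?_
    intro p hp
    rw [(hasSum_sumOfProdEq_pow hp (hs p hp)).tsum_eq]
    exact hb p hp
  refine summable_of_sum_le h0 (c := ∑' n, sumOfProdEq k n) fun s => ?_
  calc ∑ d ∈ s, k d = ∑ n ∈ s.image (fun d => ∏ i, d i), ∑ d ∈ s with ∏ i, d i = n, k d :=
        (Finset.sum_fiberwise_of_maps_to (fun d hd => Finset.mem_image_of_mem _ hd) _).symm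
    _ ≤ ∑ n ∈ s.image (fun d => ∏ i, d i), sumOfProdEq k n := by
        refine Finset.sum_le_sum fun n _ => ?_
        rw [← Finset.sum_filter_add_sum_filter_not _ (fun d : ι → ℕ => ∃ i, d i = 0),
          Finset.sum_eq_zero (s := Finset.filter (fun d : ι → ℕ => ∃ i, d i = 0) _), zero_add]
        · refine Finset.sum_le_sum_of_subset_of_nonneg ?_ fun _ _ _ => h0 _
          intro d hd
          simp only [Finset.mem_filter, not_exists] at hd
          rw [Finset.mem_filter, mem_tupleDivisors]
          refine ⟨fun i => ⟨?_, ?_⟩, hd.1.2⟩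
          · rw [← hd.1.2]
            exact Finset.dvd_prod_of_mem d (Finset.mem_univ i)
          · rw [← hd.1.2]
            exact Finset.prod_ne_zero_iff.2 fun i _ => hd.2 i
        · intro d hd
          rw [Finset.mem_filter] at hd
          exact hk0 d hd.2
    _ ≤ ∑' n, sumOfProdEq k n := hF.sum_le_tsum _ fun n _ => hF0 n

lemma hasProd_of_tupleMultiplicative [Nonempty ι] {k : (ι → ℕ) → ℝ}
    (hk : IsTupleMultiplicative k)
    (hk0 : ∀ d : ι → ℕ, (∃ i, d i = 0) → k d = 0) (hs : Summable k) :
    HasProd (fun p : Nat.Primes => ∑' ν, k (powTuple p ν)) (∑' d, k d) := by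
  have h := hasSum_sumOfProdEq hk0 hs
  have h2 := EulerProduct.eulerProduct_hasProd (sumOfProdEq_one hk) (sumOfProdEq_mul hk)
    h.summable.norm sumOfProdEq_zero
  rw [h.tsum_eq] at h2
  have h3 : ∀ p : Nat.Primes, ∑' ν, k (powTuple p ν) = ∑' e, sumOfProdEq k ((p : ℕ) ^ e) :=
    fun p => (hasSum_sumOfProdEq_pow p.2
      (hs.comp_injective (powTuple_injective p.2))).tsum_eq.symm
  simpa only [h3] using h2

end EulerProduct

/-! ### The Dirichlet inverse of `τ`, whose local generating function is `(1 - t) ^ 2`. -/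

section InverseDivisorFunction

/-- The Dirichlet inverse of the divisor function. -/
noncomputable def divisorCountInv : ArithmeticFunction ℝ :=
  (ArithmeticFunction.moebius : ArithmeticFunction ℝ) * (ArithmeticFunction.moebius :)

lemma divisorCountInv_isMultiplicative : divisorCountInv.IsMultiplicative :=
  ArithmeticFunction.isMultiplicative_moebius.intCast.mul
    ArithmeticFunction.isMultiplicative_moebius.intCast

lemma zeta_mul_zeta_apply (n : ℕ) :
    ((ArithmeticFunction.zeta : ArithmeticFunction ℝ) * (ArithmeticFunction.zeta :)) n =
      (divisorCount n : ℝ) := by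
  rw [ArithmeticFunction.coe_zeta_mul_apply, divisorCount]
  have : ∀ i ∈ n.divisors, (ArithmeticFunction.zeta : ArithmeticFunction ℝ) i = 1 := by
    intro i hi
    simp [(Nat.pos_of_mem_divisors hi).ne']
  rw [Finset.sum_congr rfl this]
  simp

lemma divisorCountInv_mul : divisorCountInv *
    ((ArithmeticFunction.zeta : ArithmeticFunction ℝ) * (ArithmeticFunction.zeta :)) = 1 := by
  have h := ArithmeticFunction.coe_moebius_mul_coe_zeta (R := ℝ)
  rw [divisorCountInv, mul_mul_mul_comm, h, one_mul]

/-- The values of `divisorCountInv` at prime powers. -/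
def divisorCountInvPow (k : ℕ) : ℝ :=
  if k = 0 then 1 else if k = 1 then -2 else if k = 2 then 1 else 0

lemma abs_divisorCountInvPow_le (k : ℕ) : |divisorCountInvPow k| ≤ 2 := by
  unfold divisorCountInvPow
  split_ifs <;> norm_num

lemma divisorCountInv_prime_pow {p : ℕ} (hp : p.Prime) (k : ℕ) :
    divisorCountInv (p ^ k) = divisorCountInvPow k := by
  have hμ : ∀ j, ((ArithmeticFunction.moebius (p ^ j) : ℤ) : ℝ) =
      if j = 0 then 1 else if j = 1 then -1 else 0 := by
    intro j
    rcases eq_or_ne j 0 with rfl | hj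
    · simp
    · rw [ArithmeticFunction.moebius_apply_prime_pow hp hj, if_neg hj]
      split_ifs <;> simp
  rw [divisorCountInv, ArithmeticFunction.mul_apply,
    Nat.sum_divisorsAntidiagonal (f := fun a b =>
      (ArithmeticFunction.moebius : ArithmeticFunction ℝ) a *
        (ArithmeticFunction.moebius : ArithmeticFunction ℝ) b), Nat.sum_divisors_prime_pow hp]
  have h : ∀ j ∈ Finset.range (k + 1), (ArithmeticFunction.moebius : ArithmeticFunction ℝ) (p ^ j) *
      (ArithmeticFunction.moebius : ArithmeticFunction ℝ) (p ^ k / p ^ j) =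
      (if j = 0 then 1 else if j = 1 then -1 else 0) *
        (if k - j = 0 then 1 else if k - j = 1 then -1 else 0) := by
    intro j hj
    rw [Nat.pow_div (Nat.lt_succ_iff.1 (Finset.mem_range.1 hj)) hp.pos,
      ArithmeticFunction.intCoe_apply, ArithmeticFunction.intCoe_apply, hμ, hμ]
  rw [Finset.sum_congr rfl h]
  match k with
  | 0 => simp [divisorCountInvPow]
  | 1 => norm_num [divisorCountInvPow, Finset.sum_range_succ]
  | 2 => norm_num [divisorCountInvPow, Finset.sum_range_succ]
  | k + 3 =>
    rw [Finset.sum_eq_zero]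
    · simp [divisorCountInvPow]
    · intro j _
      by_cases h0 : j = 0
      · simp [h0]
      · by_cases h1 : j = 1
        · simp [h1]
        · simp [h0, h1]

/-- These are the coefficients of `(1 - t)⁻² (1 - t)² = 1`. After reversal only three terms can
survive: `(k + 1) - 2k + (k - 1) = 0`. -/
lemma sum_succ_mul_divisorCountInvPow {k : ℕ} (hk : k ≠ 0) :
    ∑ l ∈ Finset.range (k + 1), ((l : ℝ) + 1) * divisorCountInvPow (k - l) = 0 := by
  rw [← Finset.sum_range_reflect]
  have h : ∀ j ∈ Finset.range (k + 1), (((k + 1 - 1 - j : ℕ) : ℝ) + 1) *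
      divisorCountInvPow (k - (k + 1 - 1 - j)) = ((k : ℝ) - j + 1) * divisorCountInvPow j := by
    intro j hj
    have hj' : j ≤ k := Nat.lt_succ_iff.1 (Finset.mem_range.1 hj)
    rw [Nat.add_sub_cancel, Nat.sub_sub_self hj', Nat.cast_sub hj']
  rw [Finset.sum_congr rfl h]
  match k, hk with
  | 1, _ => norm_num [divisorCountInvPow, Finset.sum_range_succ]
  | k + 2, _ =>
    rw [Finset.sum_range_succ', Finset.sum_range_succ', Finset.sum_range_succ',
      Finset.sum_eq_zero]
    · norm_num [divisorCountInvPow]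
      ring
    · intro j _
      simp [divisorCountInvPow]

lemma summable_norm_divisorCountInvPow (t : ℝ) :
    Summable fun k => ‖divisorCountInvPow k * t ^ k‖ := by
  refine summable_of_ne_finset_zero (s := Finset.range 3) fun k hk => ?_
  have hk' : 3 ≤ k := by simpa using hk
  rw [divisorCountInvPow, if_neg (by lia), if_neg (by lia), if_neg (by lia)]
  simp

lemma tsum_divisorCountInvPow (t : ℝ) : ∑' k, divisorCountInvPow k * t ^ k = (1 - t) ^ 2 := by
  rw [tsum_eq_sum (s := Finset.range 3)]
  · norm_num [divisorCountInvPow, Finset.sum_range_succ]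
    ring
  · intro k hk
    have hk' : 3 ≤ k := by simpa using hk
    rw [divisorCountInvPow, if_neg (by lia), if_neg (by lia), if_neg (by lia)]
    simp

end InverseDivisorFunction

/-! ### Local analysis of the sieved function and its absolute convergence. -/

section Local

variable {r : ℕ}

/-- A multiplicative function of tuples, with value `φ ν` at `(p ^ ν₁, …, p ^ ν_r)`, which behaves
like the divisor function in each variable. -/
structure IsDivisorLike (f φ : (Fin r → ℕ) → ℝ) : Prop where
  mult : IsTupleMultiplicative f
  pow : ∀ p : ℕ, p.Prime → ∀ ν, f (powTuple p ν) = φ ν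
  nonneg : ∀ ν, 0 ≤ φ ν
  le : ∀ ν, φ ν ≤ ∏ i, ((ν i : ℝ) + 1)
  single : ∀ j k, φ (Pi.single j k) = k + 1

/-- The convolution of `f` with the inverse of the divisor function in each coordinate. -/
noncomputable def sieved (f : (Fin r → ℕ) → ℝ) : (Fin r → ℕ) → ℝ :=
  tupleConv f fun b => ∏ i, divisorCountInv (b i)

/-- The values of `sieved f` at prime powers. -/
def sievedPow (φ : (Fin r → ℕ) → ℝ) (ν : Fin r → ℕ) : ℝ :=
  ∑ a ∈ Finset.Iic ν, φ a * ∏ i, divisorCountInvPow (ν i - a i)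

variable {f φ : (Fin r → ℕ) → ℝ}

lemma sieved_eq_zero {d : Fin r → ℕ} (hd : ∃ i, d i = 0) : sieved f d = 0 := by
  rw [sieved, tupleConv, tupleDivisors_eq_empty hd, Finset.sum_empty]

lemma IsDivisorLike.sieved_mult (hf : IsDivisorLike f φ) : IsTupleMultiplicative (sieved f) :=
  hf.mult.tupleConv (isTupleMultiplicative_prod divisorCountInv_isMultiplicative)

lemma IsDivisorLike.sieved_pow (hf : IsDivisorLike f φ) {p : ℕ} (hp : p.Prime) (ν : Fin r → ℕ) :
    sieved f (powTuple p ν) = sievedPow φ ν := by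
  rw [sieved, tupleConv_powTuple _ _ hp, sievedPow]
  simp [hf.pow p hp, powTuple, divisorCountInv_prime_pow hp]

lemma powTuple_zero (p : ℕ) : powTuple p (0 : Fin r → ℕ) = 1 := by
  ext i
  simp [powTuple]

lemma IsDivisorLike.map_zero (hf : IsDivisorLike f φ) : φ 0 = 1 := by
  rw [← hf.pow 2 Nat.prime_two, powTuple_zero, hf.mult.1]

lemma IsDivisorLike.sievedPow_zero (hf : IsDivisorLike f φ) : sievedPow φ 0 = 1 := by
  rw [← hf.sieved_pow Nat.prime_two, powTuple_zero, hf.sieved_mult.1]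

/-- Along a single coordinate `φ` is the local divisor function, so convolving with the inverse of
`τ` leaves nothing. This cancellation moves the abscissa of convergence beyond what the divisor
problem requires. -/
lemma IsDivisorLike.sievedPow_single (hf : IsDivisorLike f φ) (j : Fin r) {k : ℕ} (hk : k ≠ 0) :
    sievedPow φ (Pi.single j k) = 0 := by
  rw [sievedPow, ← sum_succ_mul_divisorCountInvPow hk]
  symm
  refine Finset.sum_bij (fun l _ => Pi.single j l) ?_ ?_ ?_ ?_
  · intro l hl
    rw [Finset.mem_Iic, Pi.single_le_single]
    exact Nat.lt_succ_iff.1 (Finset.mem_range.1 hl)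
  · intro a _ b _ h
    exact Pi.single_injective j h
  · intro a ha
    rw [Finset.mem_Iic] at ha
    refine ⟨a j, ?_, ?_⟩
    · have := ha j
      rw [Pi.single_eq_same] at this
      exact Finset.mem_range.2 (Nat.lt_succ_iff.2 this)
    · ext i
      rcases eq_or_ne i j with rfl | hi
      · simp
      · have := ha i
        rw [Pi.single_eq_of_ne hi] at this ⊢
        lia
  · intro l _
    rw [hf.single, Finset.prod_eq_single j]
    · simp
    · intro i _ hi
      simp [Pi.single_eq_of_ne hi, divisorCountInvPow]
    · simp

/-- There are `∏ (ν i + 1)` terms, each at most `∏ 2 * (ν i + 1)`. -/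
lemma IsDivisorLike.abs_sievedPow_le (hf : IsDivisorLike f φ) (ν : Fin r → ℕ) :
    |sievedPow φ ν| ≤ ∏ i, 2 * ((ν i : ℝ) + 1) ^ 2 := by
  have h1 : ∀ a ∈ Finset.Iic ν, |φ a * ∏ i, divisorCountInvPow (ν i - a i)| ≤
      ∏ i, 2 * ((ν i : ℝ) + 1) := by
    intro a ha
    rw [Finset.mem_Iic] at ha
    rw [abs_mul, abs_of_nonneg (hf.nonneg a), Finset.abs_prod]
    refine (mul_le_mul_of_nonneg_right (hf.le a) (Finset.prod_nonneg fun _ _ => abs_nonneg _)).trans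
      ?_
    rw [← Finset.prod_mul_distrib]
    refine Finset.prod_le_prod (fun i _ => by positivity) fun i _ => ?_
    rw [mul_comm]
    have : (a i : ℝ) ≤ ν i := by exact_mod_cast ha i
    exact mul_le_mul (abs_divisorCountInvPow_le _) (by linarith) (by positivity) (by norm_num)
  calc |sievedPow φ ν| ≤ ∑ a ∈ Finset.Iic ν, |φ a * ∏ i, divisorCountInvPow (ν i - a i)| :=
        Finset.abs_sum_le_sum_abs _ _
    _ ≤ ∑ a ∈ Finset.Iic ν, ∏ i, 2 * ((ν i : ℝ) + 1) := Finset.sum_le_sum h1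
    _ = ∏ i, 2 * ((ν i : ℝ) + 1) ^ 2 := by
        rw [Finset.sum_const, nsmul_eq_mul, Pi.card_Iic]
        push_cast
        rw [← Finset.prod_mul_distrib]
        refine Finset.prod_congr rfl fun i _ => ?_
        rw [Nat.card_Iic]
        push_cast
        ring

/-- The weight `∏ d_i ^ (-σ_i)`. -/
noncomputable def tupleWeight (σ : Fin r → ℝ) (d : Fin r → ℕ) : ℝ := ∏ i, (d i : ℝ) ^ (-σ i)

lemma tupleWeight_nonneg (σ : Fin r → ℝ) (d : Fin r → ℕ) : 0 ≤ tupleWeight σ d :=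
  Finset.prod_nonneg fun _ _ => by positivity

lemma tupleWeight_mult (σ : Fin r → ℝ) : IsTupleMultiplicative (tupleWeight σ) := by
  constructor
  · simp [tupleWeight]
  · intro a b _
    unfold tupleWeight
    rw [← Finset.prod_mul_distrib]
    refine Finset.prod_congr rfl fun i _ => ?_
    rw [Pi.mul_apply, Nat.cast_mul, Real.mul_rpow (Nat.cast_nonneg _) (Nat.cast_nonneg _)]

lemma tupleWeight_powTuple (σ : Fin r → ℝ) {p : ℕ} (hp : 0 < p) (ν : Fin r → ℕ) :
    tupleWeight σ (powTuple p ν) = (p : ℝ) ^ (-∑ i, σ i * ν i) := by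
  have hp' : (0 : ℝ) < p := by exact_mod_cast hp
  rw [tupleWeight, ← Finset.sum_neg_distrib, Real.rpow_sum_of_pos hp']
  refine Finset.prod_congr rfl fun i _ => ?_
  rw [powTuple, Nat.cast_pow, ← Real.rpow_natCast, ← Real.rpow_mul hp'.le]
  congr 1
  ring

/-- A summable majorant, independent of the prime. -/
noncomputable def localMajorant (σ : Fin r → ℝ) (ν : Fin r → ℕ) : ℝ :=
  (∏ i, 2 * ((ν i : ℝ) + 1) ^ 2) * tupleWeight σ (powTuple 2 ν)

lemma localMajorant_nonneg (σ : Fin r → ℝ) (ν : Fin r → ℕ) : 0 ≤ localMajorant σ ν :=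
  mul_nonneg (Finset.prod_nonneg fun _ _ => by positivity) (tupleWeight_nonneg _ _)

lemma summable_localMajorant {σ : Fin r → ℝ} (hσ : ∀ i, 0 < σ i) :
    Summable (localMajorant σ) := by
  have key : ∀ ν : Fin r → ℕ, localMajorant σ ν =
      ∏ i, 2 * ((ν i : ℝ) + 1) ^ 2 * ((2 : ℝ) ^ (-σ i)) ^ ν i := by
    intro ν
    rw [localMajorant, tupleWeight, ← Finset.prod_mul_distrib]
    refine Finset.prod_congr rfl fun i _ => ?_
    rw [powTuple, Nat.cast_pow, Nat.cast_ofNat, Real.rpow_pow_comm (by norm_num)]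
  have h := (summable_norm_prod_and_tsum_prod
    (fun i k => 2 * ((k : ℝ) + 1) ^ 2 * ((2 : ℝ) ^ (-σ i)) ^ k) ?_).1.of_norm
  · exact h.congr fun ν => (key ν).symm
  · intro i
    have ht : ‖(2 : ℝ) ^ (-σ i)‖ < 1 := by
      rw [Real.norm_of_nonneg (by positivity)]
      exact Real.rpow_lt_one_of_one_lt_of_neg (by norm_num) (by linarith [hσ i])
    have h0 := summable_pow_mul_geometric_of_norm_lt_one 0 ht
    have h1 := summable_pow_mul_geometric_of_norm_lt_one 1 ht
    have h2 := summable_pow_mul_geometric_of_norm_lt_one 2 ht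
    refine Summable.norm ((((h2.mul_left 2).add (h1.mul_left 4)).add (h0.mul_left 2)).congr
      fun k => ?_)
    ring

/-- The terms with one nonzero exponent vanish. With two of them, `S = ∑ σ l * ν l` is at least `κ`,
and writing `p ^ (-S) = (2 / p) ^ S * 2 ^ (-S)` splits off a factor `(2 / p) ^ κ` from a majorant
free of `p`. -/
lemma IsDivisorLike.abs_local_sub_le (hf : IsDivisorLike f φ) {σ : Fin r → ℝ}
    (hσ : ∀ i, 0 < σ i) {κ : ℝ} (hκ : ∀ i j, i ≠ j → κ ≤ σ i + σ j) {p : ℕ} (hp : p.Prime)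
    (ν : Fin r → ℕ) :
    |sievedPow φ ν * tupleWeight σ (powTuple p ν) - if ν = 0 then 1 else 0| ≤
      (2 / p : ℝ) ^ κ * localMajorant σ ν := by
  have hp0 : (0 : ℝ) < p := by exact_mod_cast hp.pos
  have hp2 : (2 : ℝ) ≤ p := by exact_mod_cast hp.two_le
  have hpos : 0 ≤ (2 / p : ℝ) ^ κ * localMajorant σ ν :=
    mul_nonneg (by positivity) (localMajorant_nonneg _ _)
  rcases eq_or_ne ν 0 with rfl | hν
  · simpa [powTuple_zero, (tupleWeight_mult σ).1, hf.sievedPow_zero] using hpos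
  rw [if_neg hν, sub_zero]
  obtain ⟨i, hi⟩ := Function.ne_iff.1 hν
  simp only [Pi.zero_apply] at hi
  by_cases hone : ∀ j, j ≠ i → ν j = 0
  · have h : ν = Pi.single i (ν i) := by
      ext j
      rcases eq_or_ne j i with rfl | hj
      · simp
      · rw [Pi.single_eq_of_ne hj, hone j hj]
    rw [h, hf.sievedPow_single i hi, zero_mul, abs_zero, ← h]
    exact hpos
  · push Not at hone
    obtain ⟨j, hji, hj⟩ := hone
    have hS : κ ≤ ∑ l, σ l * ν l := by
      refine (hκ j i hji).trans ?_
      have h1 : ∑ l ∈ {j, i}, σ l * ν l ≤ ∑ l, σ l * ν l :=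
        Finset.sum_le_sum_of_subset_of_nonneg (Finset.subset_univ _)
          fun l _ _ => mul_nonneg (hσ l).le (Nat.cast_nonneg _)
      rw [Finset.sum_pair hji] at h1
      have hi' : (1 : ℝ) ≤ ν i := by exact_mod_cast Nat.one_le_iff_ne_zero.2 hi
      have hj' : (1 : ℝ) ≤ ν j := by exact_mod_cast Nat.one_le_iff_ne_zero.2 hj
      have := le_mul_of_one_le_right (hσ i).le hi'
      have := le_mul_of_one_le_right (hσ j).le hj'
      linarith
    rw [abs_mul, abs_of_nonneg (tupleWeight_nonneg _ _), localMajorant, mul_left_comm]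
    refine mul_le_mul (hf.abs_sievedPow_le ν) ?_ (tupleWeight_nonneg _ _)
      (Finset.prod_nonneg fun _ _ => by positivity)
    rw [tupleWeight_powTuple σ hp.pos, tupleWeight_powTuple σ two_pos]
    have h2 : (2 / p : ℝ) ^ (∑ l, σ l * ν l) ≤ (2 / p : ℝ) ^ κ :=
      Real.rpow_le_rpow_of_exponent_ge (by positivity) ((div_le_one hp0).2 hp2) hS
    refine le_trans (le_of_eq ?_) (mul_le_mul_of_nonneg_right h2 (by positivity))
    rw [Real.div_rpow (by norm_num) hp0.le, Nat.cast_ofNat, Real.rpow_neg hp0.le,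
      Real.rpow_neg (by norm_num)]
    field_simp

lemma summable_two_div_rpow {κ : ℝ} (hκ : 1 < κ) (Q : ℝ) :
    Summable fun n : ℕ => (2 / n : ℝ) ^ κ * Q := by
  have h := ((Real.summable_nat_rpow.2 (by linarith : -κ < -1)).mul_left ((2 : ℝ) ^ κ)).mul_right Q
  refine h.congr fun n => ?_
  rw [Real.div_rpow (by norm_num) (Nat.cast_nonneg _), Real.rpow_neg (Nat.cast_nonneg _),
    div_eq_mul_inv]

/-- The local sums are `1 + O(p ^ (-κ))` with `κ > 1`, so their product over the primes is bounded.
Allowing different `σ i` is essential for the error term, where one coordinate has a small exponent.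
-/
lemma IsDivisorLike.summable_sieved [NeZero r] (hf : IsDivisorLike f φ) {σ : Fin r → ℝ}
    (hσ : ∀ i, 0 < σ i) {κ : ℝ} (hκ1 : 1 < κ) (hκ : ∀ i j, i ≠ j → κ ≤ σ i + σ j) :
    Summable fun d => |sieved f d| * tupleWeight σ d := by
  have hw : ∀ p : ℕ, p.Prime → ∀ ν : Fin r → ℕ,
      |sieved f (powTuple p ν)| * tupleWeight σ (powTuple p ν) ≤
        (if ν = 0 then 1 else 0) + (2 / p : ℝ) ^ κ * localMajorant σ ν := by
    intro p hp ν
    have h := hf.abs_local_sub_le hσ hκ hp ν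
    rw [hf.sieved_pow hp]
    have h2 := abs_sub_abs_le_abs_sub (sievedPow φ ν * tupleWeight σ (powTuple p ν))
      (if ν = 0 then 1 else 0)
    have h3 : |(if ν = 0 then 1 else 0 : ℝ)| = if ν = 0 then 1 else 0 := by split_ifs <;> simp
    rw [h3, abs_mul, abs_of_nonneg (tupleWeight_nonneg σ (powTuple p ν))] at h2
    linarith
  have hs0 : Summable fun ν : Fin r → ℕ => (if ν = 0 then 1 else 0 : ℝ) :=
    (hasSum_ite_eq 0 1).summable
  have hsM : ∀ p : ℕ, Summable fun ν : Fin r → ℕ => (2 / p : ℝ) ^ κ * localMajorant σ ν :=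
    fun p => (summable_localMajorant hσ).mul_left _
  have hs : ∀ p : ℕ, p.Prime → Summable fun ν =>
      |sieved f (powTuple p ν)| * tupleWeight σ (powTuple p ν) := fun p hp =>
    Summable.of_nonneg_of_le (fun ν => mul_nonneg (abs_nonneg _) (tupleWeight_nonneg _ _))
      (hw p hp) (hs0.add (hsM p))
  refine summable_of_tupleMultiplicative_of_nonneg
    (c := fun n => (2 / n : ℝ) ^ κ * ∑' ν, localMajorant σ ν) ⟨?_, ?_⟩ ?_ ?_ hs ?_ ?_ ?_
  · simp only
    rw [hf.sieved_mult.1, (tupleWeight_mult σ).1]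
    simp
  · intro a b hab
    simp only
    rw [hf.sieved_mult.2 a b hab, (tupleWeight_mult σ).2 a b hab, abs_mul]
    ring
  · intro d hd
    rw [sieved_eq_zero hd]
    simp
  · exact fun d => mul_nonneg (abs_nonneg _) (tupleWeight_nonneg _ _)
  · exact fun n => mul_nonneg (by positivity) (tsum_nonneg (localMajorant_nonneg σ))
  · exact summable_two_div_rpow hκ1 _
  · intro p hp
    refine ((hs p hp).tsum_le_tsum (hw p hp) (hs0.add (hsM p))).trans (le_of_eq ?_)
    rw [hs0.tsum_add (hsM p), tsum_ite_eq, tsum_mul_left]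

end Local

/-! ### The leading coefficient as a nonzero Euler product. -/

section LeadingCoefficient

variable {r : ℕ} {f φ : (Fin r → ℕ) → ℝ}

lemma tupleWeight_one_powTuple {p : ℕ} (hp : 0 < p) (ν : Fin r → ℕ) :
    tupleWeight (fun _ => 1) (powTuple p ν) = (1 / p : ℝ) ^ ∑ i, ν i := by
  rw [tupleWeight_powTuple _ hp, Real.rpow_neg (Nat.cast_nonneg _), one_div, inv_pow]
  congr 1
  rw [← Real.rpow_natCast]
  simp

lemma IsDivisorLike.summable_geometric (hf : IsDivisorLike f φ) {t : ℝ} (h0 : 0 ≤ t)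
    (h1 : t < 1) : Summable fun ν => φ ν * t ^ ∑ i, ν i := by
  have ht : ‖t‖ < 1 := by rwa [Real.norm_of_nonneg h0]
  have h := (summable_norm_prod_and_tsum_prod
    (fun (_ : Fin r) k => ((k : ℝ) + 1) * t ^ k) fun _ => ?_).1
  · refine Summable.of_nonneg_of_le (fun ν => mul_nonneg (hf.nonneg ν) (by positivity))
      (fun ν => ?_) h
    rw [Real.norm_of_nonneg (Finset.prod_nonneg fun _ _ => by positivity),
      Finset.prod_mul_distrib, Finset.prod_pow_eq_pow_sum]
    exact mul_le_mul_of_nonneg_right (hf.le ν) (by positivity)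
  · refine Summable.norm ((((summable_pow_mul_geometric_of_norm_lt_one 1 ht)).add
      (summable_pow_mul_geometric_of_norm_lt_one 0 ht)).congr fun k => ?_)
    ring

lemma sum_antidiagonal_eq_sum_Iic [Finset.HasAntidiagonal (Fin r → ℕ)]
    (F G : (Fin r → ℕ) → ℝ) (ν : Fin r → ℕ) :
    ∑ x ∈ Finset.HasAntidiagonal.antidiagonal ν, F x.1 * G x.2 = ∑ a ∈ Finset.Iic ν, F a * G (ν - a) := by
  symm
  refine Finset.sum_bij (fun a _ => (a, ν - a)) ?_ ?_ ?_ ?_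
  · intro a ha
    rw [Finset.mem_Iic] at ha
    rw [Finset.HasAntidiagonal.mem_antidiagonal]
    exact add_tsub_cancel_of_le ha
  · intro a _ b _ h
    exact congrArg Prod.fst h
  · rintro ⟨a, b⟩ hab
    rw [Finset.HasAntidiagonal.mem_antidiagonal] at hab
    simp only at hab
    refine ⟨a, Finset.mem_Iic.2 (hab ▸ le_self_add), ?_⟩
    rw [← hab, add_tsub_cancel_left]
  · intro a _
    rfl

lemma tsum_mul_tsum_eq_tsum_sum_Iic {F G : (Fin r → ℕ) → ℝ} (hF : Summable fun ν => ‖F ν‖)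
    (hG : Summable fun ν => ‖G ν‖) :
    (∑' ν, F ν) * ∑' ν, G ν = ∑' ν, ∑ a ∈ Finset.Iic ν, F a * G (ν - a) := by
  let _ : Finset.HasAntidiagonal (Fin r → ℕ) := Finset.HasAntidiagonal.antidiagonalOfLocallyFinite
  simp_rw [← sum_antidiagonal_eq_sum_Iic]
  exact hF.of_norm.tsum_mul_tsum_eq_tsum_sum_antidiagonal hG.of_norm
    (summable_mul_of_summable_norm hF hG)

/-- On generating functions, sieving multiplies by `(1 - t) ^ 2` for each coordinate. -/
lemma IsDivisorLike.tsum_sievedPow (hf : IsDivisorLike f φ) {t : ℝ} (h0 : 0 ≤ t) (h1 : t < 1) :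
    ∑' ν, sievedPow φ ν * t ^ ∑ i, ν i = (1 - t) ^ (2 * r) * ∑' ν, φ ν * t ^ ∑ i, ν i := by
  obtain ⟨h2, h3⟩ := summable_norm_prod_and_tsum_prod
    (fun (_ : Fin r) k => divisorCountInvPow k * t ^ k)
    fun _ => summable_norm_divisorCountInvPow t
  have h5 := tsum_mul_tsum_eq_tsum_sum_Iic (hf.summable_geometric h0 h1).norm h2
  simp only [h3, tsum_divisorCountInvPow, Finset.prod_const, Finset.card_univ, Fintype.card_fin]
    at h5
  rw [pow_mul, mul_comm, h5]
  refine tsum_congr fun ν => ?_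
  rw [sievedPow, Finset.sum_mul]
  refine Finset.sum_congr rfl fun a ha => ?_
  rw [Finset.mem_Iic] at ha
  rw [Finset.prod_mul_distrib, Finset.prod_pow_eq_pow_sum]
  simp only [Pi.sub_apply]
  have h6 : ∑ i, ν i = ∑ i, a i + ∑ i, (ν i - a i) := by
    rw [← Finset.sum_add_distrib]
    exact Finset.sum_congr rfl fun i _ => (Nat.add_sub_cancel' (ha i)).symm
  rw [h6, pow_add]
  ring

lemma summable_sieved_one [NeZero r] (hf : IsDivisorLike f φ) :
    Summable fun d => sieved f d * tupleWeight (fun _ => 1) d := by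
  have h := hf.summable_sieved (σ := fun _ => 1) (fun _ => one_pos) (κ := 2) (by norm_num)
    (fun _ _ _ => by norm_num)
  refine Summable.of_norm (h.congr fun d => ?_)
  rw [norm_mul, Real.norm_eq_abs, Real.norm_of_nonneg (tupleWeight_nonneg _ _)]

/-- The constant `∑_d h(d) / (d₁ ⋯ d_r)`, where `h` is the sieved function. -/
noncomputable def leadingConst (f : (Fin r → ℕ) → ℝ) : ℝ :=
  ∑' d, sieved f d * tupleWeight (fun _ => 1) d

lemma IsDivisorLike.tsum_local (hf : IsDivisorLike f φ) {p : ℕ} (hp : p.Prime) :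
    ∑' ν, sieved f (powTuple p ν) * tupleWeight (fun _ => 1) (powTuple p ν) =
      (1 - 1 / (p : ℝ)) ^ (2 * r) * ∑' ν, φ ν * (1 / p : ℝ) ^ ∑ i, ν i := by
  simp only [hf.sieved_pow hp, tupleWeight_one_powTuple hp.pos]
  refine hf.tsum_sievedPow (by positivity) ?_
  rw [div_lt_one (by exact_mod_cast hp.pos)]
  exact_mod_cast hp.one_lt

lemma IsDivisorLike.hasProd [NeZero r] (hf : IsDivisorLike f φ) :
    HasProd (fun p : Nat.Primes => (1 - 1 / (p : ℝ)) ^ (2 * r) *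
      ∑' ν, φ ν * (1 / p : ℝ) ^ ∑ i, ν i) (leadingConst f) := by
  have h := hasProd_of_tupleMultiplicative (k := fun d => sieved f d * tupleWeight (fun _ => 1) d)
    ⟨?_, ?_⟩ ?_ (summable_sieved_one hf)
  · have h2 : ∀ p : Nat.Primes, _ := fun p => hf.tsum_local p.2
    simpa only [h2, leadingConst] using h
  · simp only
    rw [hf.sieved_mult.1, (tupleWeight_mult _).1, mul_one]
  · intro a b hab
    simp only
    rw [hf.sieved_mult.2 a b hab, (tupleWeight_mult _).2 a b hab]
    ring
  · intro d hd
    rw [sieved_eq_zero hd, zero_mul]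

/-- Needed for the degree to be exactly `r`. Each Euler factor is positive, because the term `ν = 0`
is 1, and differs from 1 by `O(p ^ (-2))`; such a product cannot vanish. -/
lemma IsDivisorLike.leadingConst_ne_zero [NeZero r] (hf : IsDivisorLike f φ) :
    leadingConst f ≠ 0 := by
  have hp := hf.hasProd
  set E : Nat.Primes → ℝ := fun p => (1 - 1 / (p : ℝ)) ^ (2 * r) *
      ∑' ν, φ ν * (1 / p : ℝ) ^ ∑ i, ν i with hE
  have hlt : ∀ p : Nat.Primes, (1 / p : ℝ) < 1 := by
    intro p
    rw [div_lt_one (by exact_mod_cast p.2.pos)]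
    exact_mod_cast p.2.one_lt
  have h := tprod_one_add_ne_zero_of_summable (f := fun p => E p - 1) ?_ ?_
  · have h1 : (fun p => 1 + (E p - 1)) = E := funext fun p => add_sub_cancel _ _
    rwa [h1, hp.tprod_eq] at h
  · intro p
    rw [add_sub_cancel]
    refine mul_ne_zero (pow_ne_zero _ (sub_pos.2 (hlt p)).ne') ?_
    have hs := hf.summable_geometric (t := 1 / p) (by positivity) (hlt p)
    refine (hs.tsum_pos (fun ν => mul_nonneg (hf.nonneg ν) (by positivity)) 0 ?_).ne'
    simp [hf.map_zero]
  · have hs0 : HasSum (fun ν : Fin r → ℕ => (if ν = 0 then 1 else 0 : ℝ)) 1 := hasSum_ite_eq 0 1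
    have hsM := summable_localMajorant (r := r) (σ := fun _ => 1) fun _ => one_pos
    have hc := (summable_two_div_rpow (κ := 2) (by norm_num)
      (∑' ν, localMajorant (r := r) (fun _ => 1) ν)).comp_injective
        (Subtype.val_injective (p := Nat.Prime))
    refine Summable.of_nonneg_of_le (fun p => norm_nonneg _) (fun p => ?_) hc
    have hs : Summable fun ν => sieved f (powTuple p ν) * tupleWeight (fun _ => 1) (powTuple p ν) :=
      (summable_sieved_one hf).comp_injective (powTuple_injective p.2)
    have hE' : E p - 1 = ∑' ν : Fin r → ℕ, (sieved f (powTuple p ν) *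
        tupleWeight (fun _ => 1) (powTuple p ν) - if ν = 0 then 1 else 0) := by
      rw [hs.tsum_sub hs0.summable, hs0.tsum_eq, hf.tsum_local p.2]
    rw [hE']
    refine (tsum_of_norm_bounded (hsM.hasSum.mul_left _) fun ν => ?_)
    rw [hf.sieved_pow p.2]
    exact hf.abs_local_sub_le (σ := fun _ => 1) (fun _ => one_pos) (fun _ _ _ => by norm_num) p.2 ν

end LeadingCoefficient

/-! ### Uniform bounds in the one-variable divisor problem. -/

section DivisorSum

/-- The main term in the Dirichlet divisor problem. -/
noncomputable def divisorMain (y : ℝ) : ℝ :=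
  y * Real.log y + (2 * Real.eulerMascheroniConstant - 1) * y

lemma abs_two_mul_eulerMascheroni_sub_one_le :
    |2 * Real.eulerMascheroniConstant - 1| ≤ 1 := by
  rw [abs_le]
  constructor <;> linarith [Real.one_half_lt_eulerMascheroniConstant,
    Real.eulerMascheroniConstant_lt_two_thirds]

lemma divisorSum_nonneg (y : ℝ) : 0 ≤ divisorSum y :=
  Finset.sum_nonneg fun _ _ => Nat.cast_nonneg _

lemma divisorSum_eq_zero {y : ℝ} (hy : y < 1) : divisorSum y = 0 := by
  rw [divisorSum, Nat.floor_eq_zero.2 hy]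
  simp

lemma divisorSum_eq_sum_div (y : ℝ) :
    divisorSum y = ∑ d ∈ Finset.Icc 1 ⌊y⌋₊, ((⌊y⌋₊ / d : ℕ) : ℝ) := by
  have h := ArithmeticFunction.sum_Ioc_mul_zeta_eq_sum
    (ArithmeticFunction.zeta : ArithmeticFunction ℝ) ⌊y⌋₊
  have hI : Finset.Ioc 0 ⌊y⌋₊ = Finset.Icc 1 ⌊y⌋₊ := rfl
  rw [hI] at h
  simp only [zeta_mul_zeta_apply] at h
  rw [divisorSum, h]
  refine Finset.sum_congr rfl fun d hd => ?_
  rw [Finset.mem_Icc] at hd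
  rw [ArithmeticFunction.natCoe_apply, ArithmeticFunction.zeta_apply_ne (by lia), Nat.cast_one,
    one_mul]

/-- Comparison with `y` times a harmonic sum. The range `y < 1` matters, since `x / d` becomes small
when `d` runs over all tuples. -/
lemma divisorSum_le {y : ℝ} (hy : 0 < y) : divisorSum y ≤ y * (1 + |Real.log y|) := by
  rcases lt_or_ge y 1 with h | h
  · rw [divisorSum_eq_zero h]
    positivity
  have hfl : (⌊y⌋₊ : ℝ) ≤ y := Nat.floor_le hy.le
  have hfl1 : (0 : ℝ) < ⌊y⌋₊ := by exact_mod_cast Nat.floor_pos.2 h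
  rw [divisorSum_eq_sum_div]
  calc ∑ d ∈ Finset.Icc 1 ⌊y⌋₊, ((⌊y⌋₊ / d : ℕ) : ℝ) ≤ ∑ d ∈ Finset.Icc 1 ⌊y⌋₊, y * (d : ℝ)⁻¹ := by
        refine Finset.sum_le_sum fun d _ => Nat.cast_div_le.trans ?_
        rw [div_eq_mul_inv]
        exact mul_le_mul_of_nonneg_right hfl (by positivity)
    _ = y * (harmonic ⌊y⌋₊ : ℚ) := by
        rw [← Finset.mul_sum, harmonic_eq_sum_Icc]
        push_cast
        rfl
    _ ≤ y * (1 + |Real.log y|) := by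
        refine mul_le_mul_of_nonneg_left ((harmonic_le_one_add_log _).trans ?_) hy.le
        have := Real.log_le_log hfl1 hfl
        linarith [le_abs_self (Real.log y)]

lemma abs_divisorMain_le {y : ℝ} (hy : 0 < y) : |divisorMain y| ≤ y * (1 + |Real.log y|) := by
  rw [divisorMain]
  refine (abs_add_le _ _).trans ?_
  rw [abs_mul, abs_mul, abs_of_pos hy]
  have := mul_le_mul_of_nonneg_right abs_two_mul_eulerMascheroni_sub_one_le hy.le
  linarith

lemma div_mul_one_add_abs_log_le {δ : ℝ} (hδ : 0 < δ) {x : ℝ} (hx : 1 ≤ x) {d : ℕ} (hd : 1 ≤ d) :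
    x / d * (1 + |Real.log (x / d)|) ≤
      (1 + 2 / δ) * (x ^ (1 + δ) * (d : ℝ) ^ (-(1 - δ))) := by
  have hd' : (1 : ℝ) ≤ d := by exact_mod_cast hd
  have hx0 : 0 < x := by linarith
  have hd0 : (0 : ℝ) < d := by linarith
  have hX : 1 ≤ x ^ δ := Real.one_le_rpow hx hδ.le
  have hD : 1 ≤ (d : ℝ) ^ δ := Real.one_le_rpow hd' hδ.le
  have h1 : |Real.log (x / d)| ≤ Real.log x + Real.log d := by
    rw [Real.log_div hx0.ne' hd0.ne', abs_le]
    have := Real.log_nonneg hx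
    have := Real.log_nonneg hd'
    constructor <;> linarith
  have h2 := Real.log_le_rpow_div hx0.le hδ
  have h3 := Real.log_le_rpow_div hd0.le hδ
  have h4 : x ^ δ / δ ≤ x ^ δ * (d : ℝ) ^ δ / δ :=
    div_le_div_of_nonneg_right (le_mul_of_one_le_right (by linarith) hD) hδ.le
  have h5 : (d : ℝ) ^ δ / δ ≤ x ^ δ * (d : ℝ) ^ δ / δ :=
    div_le_div_of_nonneg_right (le_mul_of_one_le_left (by linarith) hX) hδ.le
  have h6 : 1 ≤ x ^ δ * (d : ℝ) ^ δ := one_le_mul_of_one_le_of_one_le hX hD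
  have h7 : 1 + |Real.log (x / d)| ≤ (1 + 2 / δ) * (x ^ δ * (d : ℝ) ^ δ) := by
    have : (1 + 2 / δ) * (x ^ δ * (d : ℝ) ^ δ) =
      x ^ δ * (d : ℝ) ^ δ + 2 * (x ^ δ * (d : ℝ) ^ δ / δ) := by ring
    rw [this]
    linarith
  refine (mul_le_mul_of_nonneg_left h7 (by positivity)).trans (le_of_eq ?_)
  rw [Real.rpow_add hx0, Real.rpow_one, neg_sub, Real.rpow_sub hd0, Real.rpow_one]
  ring

lemma mul_one_add_abs_log_le {σ : ℝ} (hσ0 : 0 < σ) (hσ1 : σ < 1) {X y : ℝ} (hX : 1 ≤ X)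
    (hy0 : 0 < y) (hy : y ≤ X) :
    y * (1 + |Real.log y|) ≤ (X * (1 + Real.log X) + 1 / (1 - σ)) * y ^ σ := by
  have hX' : 0 ≤ Real.log X := Real.log_nonneg hX
  have hσ' : 0 < 1 - σ := by linarith
  rcases le_total y 1 with h | h
  · have h1 : |Real.log y| ≤ y ^ (σ - 1) / (1 - σ) := by
      rw [abs_of_nonpos (Real.log_nonpos hy0.le h), ← Real.log_inv]
      refine (Real.log_le_rpow_div (by positivity) hσ').trans (le_of_eq ?_)
      rw [Real.inv_rpow hy0.le, ← Real.rpow_neg hy0.le, neg_sub]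
    have h2 : y * (y ^ (σ - 1) / (1 - σ)) = 1 / (1 - σ) * y ^ σ := by
      rw [Real.rpow_sub_one hy0.ne']
      field_simp
    have h3 : y ≤ y ^ σ := by
      conv_lhs => rw [← Real.rpow_one y]
      exact Real.rpow_le_rpow_of_exponent_ge hy0 h hσ1.le
    have h4 : 1 ≤ X * (1 + Real.log X) := one_le_mul_of_one_le_of_one_le hX (by linarith)
    have h5 : y ^ σ ≤ X * (1 + Real.log X) * y ^ σ :=
      le_mul_of_one_le_left (by positivity) h4
    have h6 := mul_le_mul_of_nonneg_left h1 hy0.le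
    rw [h2] at h6
    linarith
  · have h1 : 1 ≤ y ^ σ := Real.one_le_rpow h hσ0.le
    have h2 : y * (1 + |Real.log y|) ≤ X * (1 + Real.log X) := by
      rw [abs_of_nonneg (Real.log_nonneg h)]
      have := Real.log_nonneg h
      have := Real.log_le_log hy0 hy
      exact mul_le_mul hy (by linarith) (by linarith) (by linarith)
    have h3 : 0 < 1 / (1 - σ) := by positivity
    have h4 : 0 ≤ X * (1 + Real.log X) := by positivity
    exact (h2.trans (le_add_of_nonneg_right h3.le)).trans
      (le_mul_of_one_le_right (by linarith) h1)

/-- The hypothesis only speaks of large arguments. When `x / d` is bounded, trivial bounds give `(x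
/ d) ^ σ`, where `σ < 1` absorbs the logarithm of the main term near `0`; then `σ ≤ η` and `x, d ≥
1` bring both cases to the same form. -/
lemma exists_abs_divisorSum_sub_le {η σ : ℝ} (hσ0 : 0 < σ) (hσ1 : σ < 1) (hση : σ ≤ η)
    (h : (fun x => divisorSum x - divisorMain x) =O[atTop] fun x => x ^ η) :
    ∃ C : ℝ, 0 ≤ C ∧ ∀ x : ℝ, 1 ≤ x → ∀ d : ℕ, 1 ≤ d →
      |divisorSum (x / d) - divisorMain (x / d)| ≤ C * (x ^ η * (d : ℝ) ^ (-σ)) := by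
  obtain ⟨C₀, hC₀, hO⟩ := h.exists_pos
  rw [isBigOWith_iff, eventually_atTop] at hO
  obtain ⟨X₀, hX₀⟩ := hO
  set X := max X₀ 1
  have hX1 : 1 ≤ X := le_max_right _ _
  set C₁ := 2 * (X * (1 + Real.log X) + 1 / (1 - σ))
  have hC₁ : 0 ≤ C₁ := by
    have := Real.log_nonneg hX1
    have : 0 < 1 / (1 - σ) := one_div_pos.2 (by linarith)
    positivity
  refine ⟨C₀ + C₁, by positivity, fun x hx d hd => ?_⟩
  have hd' : (1 : ℝ) ≤ d := by exact_mod_cast hd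
  have hx0 : 0 < x := by linarith
  have hd0 : (0 : ℝ) < d := by linarith
  have hy0 : 0 < x / d := by positivity
  have hT : 0 ≤ x ^ η * (d : ℝ) ^ (-σ) := by positivity
  have hdiv : ∀ s : ℝ, (x / d) ^ s = x ^ s * (d : ℝ) ^ (-s) := fun s => by
    rw [Real.div_rpow hx0.le hd0.le, div_eq_mul_inv, Real.rpow_neg hd0.le]
  rw [add_mul]
  rcases le_total X (x / d) with hy | hy
  · have h1 := hX₀ (x / d) ((le_max_left _ _).trans hy)
    rw [Real.norm_eq_abs, Real.norm_of_nonneg (by positivity), hdiv] at h1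
    have h2 : (d : ℝ) ^ (-η) ≤ (d : ℝ) ^ (-σ) :=
      Real.rpow_le_rpow_of_exponent_le hd' (by linarith)
    have h3 : C₀ * (x ^ η * (d : ℝ) ^ (-η)) ≤ C₀ * (x ^ η * (d : ℝ) ^ (-σ)) := by gcongr
    have := mul_nonneg hC₁ hT
    linarith
  · have h1 := mul_one_add_abs_log_le hσ0 hσ1 hX1 hy0 hy
    have h2 : |divisorSum (x / d) - divisorMain (x / d)| ≤ C₁ * (x / d) ^ σ := by
      refine (abs_sub _ _).trans ?_
      rw [abs_of_nonneg (divisorSum_nonneg _)]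
      have := divisorSum_le hy0
      have := abs_divisorMain_le hy0
      simp only [C₁]
      linarith
    rw [hdiv] at h2
    have h3 : x ^ σ ≤ x ^ η := Real.rpow_le_rpow_of_exponent_le hx hση
    have h4 : C₁ * (x ^ σ * (d : ℝ) ^ (-σ)) ≤ C₁ * (x ^ η * (d : ℝ) ^ (-σ)) := by gcongr
    have := mul_nonneg hC₀.le hT
    linarith

/-- Between `n` and `n + 1 / 2` the divisor sum is constant while the main term grows by about `(log
n) / 2`, so the error cannot be bounded. This provides the positive exponent `σ` in the error
estimate. -/
lemma IsDivisorExponent.nonneg {θ : ℝ} (h : IsDivisorExponent θ) : 0 ≤ θ := by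
  by_contra! hθ
  have hO := h (-θ) (by linarith)
  simp only [add_neg_cancel, Real.rpow_zero] at hO
  obtain ⟨C, hC⟩ := hO.bound
  have hC' : ∀ᶠ x : ℝ in atTop, |divisorSum x - divisorMain x| ≤ C := by
    filter_upwards [hC] with x hx
    simpa [divisorMain] using hx
  obtain ⟨X, hX⟩ := eventually_atTop.1 hC'
  -- The main term grows by at least `(log n - 1) / 2`, and two errors bounded by `C` allow at most
  -- `2 * C`; hence `log n ≤ 4 * C + 1`, which this threshold contradicts.
  have hlog : ∀ᶠ x : ℝ in atTop, 4 * C + 2 < Real.log x :=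
    Real.tendsto_log_atTop.eventually_gt_atTop _
  obtain ⟨n, hn⟩ := (((tendsto_natCast_atTop_atTop (R := ℝ)).eventually
    (hlog.and ((eventually_ge_atTop X).and (eventually_gt_atTop 0))))).exists
  obtain ⟨h1, h2, h3⟩ := hn
  have h4 : divisorSum ((n : ℝ) + 1 / 2) = divisorSum n := by
    have : ⌊(n : ℝ) + 1 / 2⌋₊ = n := by
      rw [Nat.floor_eq_iff (by positivity)]
      constructor <;> linarith
    rw [divisorSum, divisorSum, this, Nat.floor_natCast]
  have h5 := abs_le.1 (hX n h2)
  have h6 := abs_le.1 (hX (n + 1 / 2) (by linarith))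
  rw [h4] at h6
  have h7 : divisorMain ((n : ℝ) + 1 / 2) - divisorMain n ≤ 2 * C := by linarith [h5.2, h6.1]
  have h8 : Real.log n ≤ Real.log ((n : ℝ) + 1 / 2) := Real.log_le_log h3 (by linarith)
  have h9 := mul_le_mul_of_nonneg_left h8 (by linarith : (0 : ℝ) ≤ n + 1 / 2)
  have h10 := (abs_le.1 abs_two_mul_eulerMascheroni_sub_one_le).1
  unfold divisorMain at h7
  linarith

end DivisorSum

/-! ### Passage to the divisor sums and extraction of the main polynomial. -/

section Summation

variable {r : ℕ} {f φ : (Fin r → ℕ) → ℝ}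

lemma mem_tuplesUpTo {x : ℝ} {n : Fin r → ℕ} :
    n ∈ tuplesUpTo r x ↔ ∀ i, 1 ≤ n i ∧ n i ≤ ⌊x⌋₊ := by
  simp [tuplesUpTo]

lemma prod_divisorSum (x : ℝ) (d : Fin r → ℕ) :
    ∏ i, divisorSum (x / d i) =
      ∑ e ∈ Fintype.piFinset fun i => Finset.Icc 1 (⌊x⌋₊ / d i), ∏ i, (divisorCount (e i) : ℝ) := by
  simp only [divisorSum, Nat.floor_div_natCast]
  exact Finset.prod_univ_sum _ _

/-- Substitute `n = d * e` in the convolution identity. The series is really finite, as `divisorSum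
(x / d i) = 0` when `d i > x`; written as a series, it can be compared with the full series of main
terms. -/
lemma sum_tuplesUpTo_eq_tsum (f : (Fin r → ℕ) → ℝ) (x : ℝ) :
    ∑ n ∈ tuplesUpTo r x, f n = ∑' d, sieved f d * ∏ i, divisorSum (x / d i) := by
  have h1 : ∀ n ∈ tuplesUpTo r x, f n = ∑ d ∈ tupleDivisors n,
      sieved f d * ∏ i, (divisorCount (n i / d i) : ℝ) := by
    intro n hn
    rw [mem_tuplesUpTo] at hn
    rw [← tupleConv_tupleConv_prod divisorCountInv_mul f
      (fun i => Nat.one_le_iff_ne_zero.1 (hn i).1)]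
    simp only [zeta_mul_zeta_apply]
    rfl
  rw [Finset.sum_congr rfl h1, tsum_eq_sum (s := tuplesUpTo r x)]
  · simp_rw [prod_divisorSum, Finset.mul_sum]
    rw [Finset.sum_sigma', Finset.sum_sigma']
    refine Finset.sum_bij' (fun y _ => ⟨y.2, y.1 / y.2⟩) (fun y _ => ⟨y.1 * y.2, y.1⟩)
      ?_ ?_ ?_ ?_ ?_
    · rintro ⟨n, d⟩ hy
      simp only [Finset.mem_sigma, mem_tuplesUpTo, mem_tupleDivisors, Fintype.mem_piFinset,
        Finset.mem_Icc] at hy ⊢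
      have hd : ∀ i, 0 < d i := fun i => Nat.pos_of_dvd_of_pos (hy.2 i).1 (hy.1 i).1
      have hle : ∀ i, d i ≤ n i := fun i => Nat.le_of_dvd (hy.1 i).1 (hy.2 i).1
      refine ⟨fun i => ⟨hd i, (hle i).trans (hy.1 i).2⟩, fun i => ⟨?_, ?_⟩⟩
      · exact Nat.div_pos (hle i) (hd i)
      · exact Nat.div_le_div_right (hy.1 i).2
    · rintro ⟨d, e⟩ hy
      simp only [Finset.mem_sigma, mem_tuplesUpTo, mem_tupleDivisors, Fintype.mem_piFinset,
        Finset.mem_Icc] at hy ⊢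
      have hpos : ∀ i, 0 < (d * e) i := fun i => Nat.mul_pos (hy.1 i).1 (hy.2 i).1
      refine ⟨fun i => ⟨hpos i, ?_⟩, fun i => ⟨dvd_mul_right _ _, (hpos i).ne'⟩⟩
      rw [Pi.mul_apply, mul_comm]
      exact (Nat.le_div_iff_mul_le (hy.1 i).1).1 (hy.2 i).2
    · rintro ⟨n, d⟩ hy
      simp only [Finset.mem_sigma, mem_tupleDivisors] at hy
      have : d * (n / d) = n := by
        ext i
        exact Nat.mul_div_cancel' (hy.2 i).1
      simp [this]
    · rintro ⟨d, e⟩ hy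
      simp only [Finset.mem_sigma, mem_tuplesUpTo] at hy
      have : d * e / d = e := by
        ext i
        exact Nat.mul_div_cancel_left _ (hy.1 i).1
      simp [this]
    · rintro ⟨n, d⟩ _
      rfl
  · intro d hd
    rw [mem_tuplesUpTo] at hd
    push Not at hd
    obtain ⟨i, hi⟩ := hd
    rcases Nat.eq_zero_or_pos (d i) with h0 | h0
    · rw [sieved_eq_zero ⟨i, h0⟩, zero_mul]
    · rw [Finset.prod_eq_zero (Finset.mem_univ i), mul_zero]
      rw [divisorSum, Nat.floor_div_natCast, Nat.div_eq_of_lt (hi h0)]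
      simp

/-- Telescoping: the factors are exchanged one at a time. -/
lemma abs_prod_sub_prod_le {ι : Type*} [DecidableEq ι] (s : Finset ι) {a b B : ι → ℝ}
    (ha : ∀ i, |a i| ≤ B i) (hb : ∀ i, |b i| ≤ B i) :
    |∏ i ∈ s, a i - ∏ i ∈ s, b i| ≤ ∑ j ∈ s, |a j - b j| * ∏ i ∈ s.erase j, B i := by
  induction s using Finset.induction_on with
  | empty => simp
  | insert k s hk ih =>
    have hB : ∀ i, 0 ≤ B i := fun i => (abs_nonneg _).trans (ha i)
    rw [Finset.prod_insert hk, Finset.prod_insert hk, Finset.sum_insert hk,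
      Finset.erase_insert hk]
    have h1 : a k * ∏ i ∈ s, a i - b k * ∏ i ∈ s, b i =
        (a k - b k) * ∏ i ∈ s, a i + b k * (∏ i ∈ s, a i - ∏ i ∈ s, b i) := by ring
    rw [h1]
    refine (abs_add_le _ _).trans (add_le_add ?_ ?_)
    · rw [abs_mul, Finset.abs_prod]
      exact mul_le_mul_of_nonneg_left
        (Finset.prod_le_prod (fun _ _ => abs_nonneg _) fun i _ => ha i) (abs_nonneg _)
    · rw [abs_mul]
      refine (mul_le_mul (hb k) ih (abs_nonneg _) (hB k)).trans (le_of_eq ?_)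
      rw [Finset.mul_sum]
      refine Finset.sum_congr rfl fun j hj => ?_
      have hkj : k ≠ j := fun h => hk (h ▸ hj)
      rw [Finset.erase_insert_of_ne hkj, Finset.prod_insert (fun h => hk (Finset.mem_of_mem_erase h))]
      ring

/-- The coefficient series of the main polynomial. -/
noncomputable def mainTerm (f : (Fin r → ℕ) → ℝ) (s : Finset (Fin r)) (d : Fin r → ℕ) : ℝ :=
  sieved f d * tupleWeight (fun _ => 1) d *
    ∏ i ∈ Finset.univ \ s, (2 * Real.eulerMascheroniConstant - 1 - Real.log (d i))

/-- The polynomial in `log x` of the main term. -/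
noncomputable def mainPoly (f : (Fin r → ℕ) → ℝ) : Polynomial ℝ :=
  ∑ s : Finset (Fin r), Polynomial.C (∑' d, mainTerm f s d) * Polynomial.X ^ s.card

lemma summable_mainTerm [NeZero r] (hf : IsDivisorLike f φ) (s : Finset (Fin r)) :
    Summable (mainTerm f s) := by
  -- There is room below exponent 1: each logarithmic factor is at most `1 + 4 * d ^ (1 / 4) ≤ 5 * d
  -- ^ (1 / 4)`, which lowers the weight from 1 to `3 / 4`, and `3 / 4 + 3 / 4 > 1`.
  have h := (hf.summable_sieved (σ := fun _ => 3 / 4) (fun _ => by norm_num) (κ := 3 / 2)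
    (by norm_num) (fun _ _ _ => by norm_num)).mul_left ((5 : ℝ) ^ r)
  refine Summable.of_norm_bounded h fun d => ?_
  by_cases hd : ∃ i, d i = 0
  · simp [mainTerm, sieved_eq_zero hd]
  push Not at hd
  have hd1 : ∀ i, (1 : ℝ) ≤ d i := fun i => by exact_mod_cast Nat.one_le_iff_ne_zero.2 (hd i)
  have hb : ∀ i, |2 * Real.eulerMascheroniConstant - 1 - Real.log (d i)| ≤
      5 * (d i : ℝ) ^ (1 / 4 : ℝ) := by
    intro i
    have h1 := Real.log_le_rpow_div (Nat.cast_nonneg (d i)) (ε := 1 / 4) (by norm_num)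
    have h2 : 1 ≤ (d i : ℝ) ^ (1 / 4 : ℝ) := Real.one_le_rpow (hd1 i) (by norm_num)
    have h3 := Real.log_nonneg (hd1 i)
    refine (abs_sub _ _).trans ?_
    rw [abs_of_nonneg h3]
    have := abs_two_mul_eulerMascheroni_sub_one_le
    linarith
  have hprod : |∏ i ∈ Finset.univ \ s, (2 * Real.eulerMascheroniConstant - 1 - Real.log (d i))| ≤
      5 ^ r * ∏ i, (d i : ℝ) ^ (1 / 4 : ℝ) := by
    rw [Finset.abs_prod]
    calc ∏ i ∈ Finset.univ \ s, |2 * Real.eulerMascheroniConstant - 1 - Real.log (d i)|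
        ≤ ∏ i ∈ Finset.univ \ s, (5 * (d i : ℝ) ^ (1 / 4 : ℝ)) :=
          Finset.prod_le_prod (fun _ _ => abs_nonneg _) fun i _ => hb i
      _ ≤ ∏ i, (5 * (d i : ℝ) ^ (1 / 4 : ℝ)) := by
          refine Finset.prod_le_prod_of_subset_of_one_le (Finset.subset_univ _)
            (fun i _ => by positivity) fun i _ _ => ?_
          have h2 : 1 ≤ (d i : ℝ) ^ (1 / 4 : ℝ) := Real.one_le_rpow (hd1 i) (by norm_num)
          linarith
      _ = 5 ^ r * ∏ i, (d i : ℝ) ^ (1 / 4 : ℝ) := by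
          rw [Finset.prod_mul_distrib]
          simp
  rw [mainTerm, norm_mul, norm_mul, Real.norm_eq_abs, Real.norm_eq_abs, Real.norm_eq_abs,
    abs_of_nonneg (tupleWeight_nonneg _ _)]
  have hw : tupleWeight (fun _ => 1) d * ∏ i, (d i : ℝ) ^ (1 / 4 : ℝ) =
      tupleWeight (fun _ => 3 / 4) d := by
    rw [tupleWeight, tupleWeight, ← Finset.prod_mul_distrib]
    refine Finset.prod_congr rfl fun i _ => ?_
    rw [← Real.rpow_add (by linarith [hd1 i])]
    norm_num
  rw [← hw]
  refine (mul_le_mul_of_nonneg_left hprod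
    (mul_nonneg (abs_nonneg _) (tupleWeight_nonneg _ _))).trans (le_of_eq ?_)
  ring

/-- Each factor is `(x / d i) * (log x + (2γ - 1 - log (d i)))`; in the expanded product, `s` is the
set of coordinates contributing `log x`. -/
lemma sieved_mul_prod_divisorMain (f : (Fin r → ℕ) → ℝ) {x : ℝ} (hx : 0 < x) (d : Fin r → ℕ) :
    sieved f d * ∏ i, divisorMain (x / d i) =
      x ^ r * ∑ s : Finset (Fin r), mainTerm f s d * Real.log x ^ s.card := by
  by_cases hd : ∃ i, d i = 0
  · simp [mainTerm, sieved_eq_zero hd]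
  push Not at hd
  have hd1 : ∀ i, (0 : ℝ) < d i := fun i => by exact_mod_cast Nat.pos_of_ne_zero (hd i)
  have h1 : ∀ i, divisorMain (x / d i) = x * (d i : ℝ) ^ (-1 : ℝ) *
      (Real.log x + (2 * Real.eulerMascheroniConstant - 1 - Real.log (d i))) := by
    intro i
    rw [divisorMain, Real.log_div hx.ne' (hd1 i).ne', Real.rpow_neg_one]
    ring
  simp only [h1, mainTerm]
  rw [Finset.prod_mul_distrib, Finset.prod_mul_distrib, Finset.prod_add, Finset.powerset_univ,
    Finset.mul_sum, Finset.mul_sum, Finset.mul_sum]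
  refine Finset.sum_congr rfl fun s _ => ?_
  simp only [Finset.prod_const, Finset.card_univ, Fintype.card_fin, tupleWeight]
  ring

lemma hasSum_sieved_mul_prod_divisorMain [NeZero r] (hf : IsDivisorLike f φ) {x : ℝ}
    (hx : 0 < x) : HasSum (fun d => sieved f d * ∏ i, divisorMain (x / d i))
      (x ^ r * (mainPoly f).eval (Real.log x)) := by
  simp only [sieved_mul_prod_divisorMain f hx]
  refine HasSum.mul_left _ ?_
  rw [mainPoly, Polynomial.eval_finsetSum]
  simp only [Polynomial.eval_mul, Polynomial.eval_C, Polynomial.eval_pow, Polynomial.eval_X]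
  exact hasSum_sum fun s _ => (summable_mainTerm hf s).hasSum.mul_right _

lemma coeff_mainPoly (f : (Fin r → ℕ) → ℝ) : (mainPoly f).coeff r = leadingConst f := by
  rw [mainPoly, Polynomial.finsetSum_coeff, Finset.sum_eq_single Finset.univ]
  · simp [mainTerm, leadingConst]
  · intro s _ hs
    rw [Polynomial.coeff_C_mul, Polynomial.coeff_X_pow, if_neg, mul_zero]
    intro h
    exact hs ((Finset.card_eq_iff_eq_univ s).1 (by simpa using h.symm))
  · simp

lemma natDegree_mainPoly [NeZero r] (hf : IsDivisorLike f φ) : (mainPoly f).natDegree = r := by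
  refine Polynomial.natDegree_eq_of_le_of_coeff_ne_zero ?_ ?_
  · refine Polynomial.natDegree_sum_le_of_forall_le _ _ fun s _ => ?_
    refine (Polynomial.natDegree_C_mul_X_pow_le _ _).trans ?_
    simpa using Finset.card_le_univ s
  · rw [coeff_mainPoly]
    exact hf.leadingConst_ne_zero

lemma leadingCoeff_mainPoly [NeZero r] (hf : IsDivisorLike f φ) :
    (mainPoly f).leadingCoeff = leadingConst f := by
  rw [Polynomial.leadingCoeff, natDegree_mainPoly hf, coeff_mainPoly]

end Summation

/-! ### The error term. -/

section ErrorTerm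

variable {r : ℕ} {f φ : (Fin r → ℕ) → ℝ}

lemma mul_prod_erase_eq_tupleWeight (σ τ : ℝ) (j : Fin r) (d : Fin r → ℕ) :
    (d j : ℝ) ^ (-σ) * ∏ i ∈ Finset.univ.erase j, (d i : ℝ) ^ (-τ) =
      tupleWeight (Function.update (fun _ => τ) j σ) d := by
  rw [tupleWeight, ← Finset.mul_prod_erase _ _ (Finset.mem_univ j), Function.update_self]
  congr 1
  refine Finset.prod_congr rfl fun i hi => ?_
  rw [Function.update_of_ne (Finset.ne_of_mem_erase hi)]

lemma abs_sieved_mul_prod_sub_le (f : (Fin r → ℕ) → ℝ) {η σ δ C : ℝ} (hδ : 0 < δ)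
    (hC : ∀ x : ℝ, 1 ≤ x → ∀ d : ℕ, 1 ≤ d →
      |divisorSum (x / d) - divisorMain (x / d)| ≤ C * (x ^ η * (d : ℝ) ^ (-σ)))
    {x : ℝ} (hx : 1 ≤ x) (d : Fin r → ℕ) :
    |sieved f d * ∏ i, divisorSum (x / d i) - sieved f d * ∏ i, divisorMain (x / d i)| ≤
      C * (1 + 2 / δ) ^ (r - 1) * (x ^ η * (x ^ (1 + δ)) ^ (r - 1)) *
        ∑ j, |sieved f d| * tupleWeight (Function.update (fun _ => 1 - δ) j σ) d := by
  by_cases hd : ∃ i, d i = 0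
  · simp [sieved_eq_zero hd]
  push Not at hd
  have hd1 : ∀ i, 1 ≤ d i := fun i => Nat.one_le_iff_ne_zero.2 (hd i)
  have hpos : ∀ i, 0 < x / d i := fun i =>
    div_pos (by linarith) (by exact_mod_cast hd1 i)
  have h1 := abs_prod_sub_prod_le Finset.univ (a := fun i => divisorSum (x / d i))
    (b := fun i => divisorMain (x / d i))
    (B := fun i => (1 + 2 / δ) * (x ^ (1 + δ) * (d i : ℝ) ^ (-(1 - δ))))
    (fun i => by
      rw [abs_of_nonneg (divisorSum_nonneg _)]
      exact (divisorSum_le (hpos i)).trans (div_mul_one_add_abs_log_le hδ hx (hd1 i)))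
    (fun i => (abs_divisorMain_le (hpos i)).trans (div_mul_one_add_abs_log_le hδ hx (hd1 i)))
  rw [← mul_sub, abs_mul]
  refine (mul_le_mul_of_nonneg_left h1 (abs_nonneg _)).trans ?_
  rw [Finset.mul_sum, Finset.mul_sum]
  refine Finset.sum_le_sum fun j _ => ?_
  have hP : 0 ≤ ∏ i ∈ Finset.univ.erase j, (1 + 2 / δ) * (x ^ (1 + δ) * (d i : ℝ) ^ (-(1 - δ))) :=
    Finset.prod_nonneg fun i _ => by positivity
  refine (mul_le_mul_of_nonneg_left (mul_le_mul_of_nonneg_right (hC x hx (d j) (hd1 j)) hP)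
    (abs_nonneg _)).trans (le_of_eq ?_)
  rw [← mul_prod_erase_eq_tupleWeight, Finset.prod_mul_distrib, Finset.prod_mul_distrib]
  simp only [Finset.prod_const, Finset.card_erase_of_mem (Finset.mem_univ j), Finset.card_univ,
    Fintype.card_fin]
  ring

/-- The asymptotic formula for the summatory function of a divisor-like function. -/
theorem IsDivisorLike.isBigO_sum_sub (hr : 1 ≤ r) (hf : IsDivisorLike f φ) {θ : ℝ}
    (hθ : IsDivisorExponent θ) {ε : ℝ} (hε : 0 < ε) :
    (fun x : ℝ => ∑ n ∈ tuplesUpTo r x, f n - x ^ r * (mainPoly f).eval (Real.log x))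
      =O[atTop] fun x : ℝ => x ^ ((r : ℝ) - 1 + θ + ε) := by
  have : NeZero r := ⟨by lia⟩
  have hr0 : (0 : ℝ) < r := by exact_mod_cast hr
  have hθ0 := hθ.nonneg
  set η := θ + ε / 2 with hη
  have hη0 : 0 < η := by linarith
  -- The cap `1 / 2` ensures `σ < 1`, and makes two coordinates of weight `1 - δ` suffice: `2 * (1 -
  -- δ) ≥ 2 - σ ≥ 1 + σ / 2`.
  set σ := min η (1 / 2) with hσ
  have hσ0 : 0 < σ := lt_min hη0 (by norm_num)
  have hσ1 : σ ≤ 1 / 2 := min_le_right _ _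
  -- The first bound gives `σ + (1 - δ) ≥ 1 + σ / 2`, hence convergence; the second keeps the total
  -- loss `x ^ ((r - 1) * δ)` within `x ^ (ε / 2)`.
  set δ := min (σ / 2) (ε / (2 * r)) with hδ
  have hδ0 : 0 < δ := lt_min (by linarith) (by positivity)
  have hδ1 : δ ≤ σ / 2 := min_le_left _ _
  have hδ2 : r * δ ≤ ε / 2 := by
    have : δ ≤ ε / (2 * r) := min_le_right _ _
    calc r * δ ≤ r * (ε / (2 * r)) := mul_le_mul_of_nonneg_left this hr0.le
      _ = ε / 2 := by field_simp
  obtain ⟨C, hC0, hC⟩ := exists_abs_divisorSum_sub_le hσ0 (by linarith) (min_le_left η (1 / 2))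
    (hθ (ε / 2) (by linarith))
  have hs : Summable fun d => ∑ j, |sieved f d| *
      tupleWeight (Function.update (fun _ => 1 - δ) j σ) d := by
    refine summable_sum fun j _ => hf.summable_sieved (κ := 1 + σ / 2) (fun i => ?_) (by linarith)
      fun i k hik => ?_
    · rcases eq_or_ne i j with rfl | h
      · rwa [Function.update_self]
      · rw [Function.update_of_ne h]
        linarith
    · rcases eq_or_ne i j with rfl | h
      · rw [Function.update_self, Function.update_of_ne hik.symm]
        linarith
      · rw [Function.update_of_ne h]
        rcases eq_or_ne k j with rfl | h'
        · rw [Function.update_self]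
          linarith
        · rw [Function.update_of_ne h']
          linarith
  refine IsBigO.of_bound (C * (1 + 2 / δ) ^ (r - 1) * ∑' d, ∑ j, |sieved f d| *
      tupleWeight (Function.update (fun _ => 1 - δ) j σ) d) ?_
  filter_upwards [eventually_ge_atTop 1] with x hx
  have hx0 : 0 < x := by linarith
  have hM := hasSum_sieved_mul_prod_divisorMain hf hx0
  have hb := abs_sieved_mul_prod_sub_le f hδ0 hC hx
  have hdiff : Summable fun d => sieved f d * ∏ i, divisorSum (x / d i) -
      sieved f d * ∏ i, divisorMain (x / d i) :=
    Summable.of_norm_bounded (hs.mul_left _) hb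
  have hD : Summable fun d => sieved f d * ∏ i, divisorSum (x / d i) :=
    (hdiff.add hM.summable).congr fun d => by ring
  rw [sum_tuplesUpTo_eq_tsum, ← hM.tsum_eq, ← hD.tsum_sub hM.summable]
  refine (tsum_of_norm_bounded (hs.hasSum.mul_left _) hb).trans ?_
  have hexp : x ^ η * (x ^ (1 + δ)) ^ (r - 1) ≤ x ^ ((r : ℝ) - 1 + θ + ε) := by
    rw [← Real.rpow_natCast, ← Real.rpow_mul hx0.le, ← Real.rpow_add hx0]
    refine Real.rpow_le_rpow_of_exponent_le hx ?_
    rw [Nat.cast_sub hr]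
    push_cast
    linarith
  rw [Real.norm_of_nonneg (by positivity)]
  have hS : 0 ≤ ∑' d, ∑ j, |sieved f d| *
      tupleWeight (Function.update (fun _ => 1 - δ) j σ) d :=
    tsum_nonneg fun d => Finset.sum_nonneg fun j _ =>
      mul_nonneg (abs_nonneg _) (tupleWeight_nonneg _ _)
  have hK : 0 ≤ C * (1 + 2 / δ) ^ (r - 1) * ∑' d, ∑ j, |sieved f d| *
      tupleWeight (Function.update (fun _ => 1 - δ) j σ) d := by positivity
  refine le_trans (le_of_eq ?_) (mul_le_mul_of_nonneg_left hexp hK)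
  ring

end ErrorTerm

/-! ### The product and the least common multiple as divisor-like functions, and their Euler
factors. -/

section Examples

variable {r : ℕ}

lemma divisorCount_mul {m n : ℕ} (h : m.Coprime n) :
    divisorCount (m * n) = divisorCount m * divisorCount n :=
  h.card_divisors_mul

lemma divisorCount_prime_pow {p : ℕ} (hp : p.Prime) (k : ℕ) : divisorCount (p ^ k) = k + 1 := by
  rw [divisorCount, Nat.divisors_prime_pow hp, Finset.card_map, Finset.card_range]

lemma sum_add_one_le_prod (ν : Fin r → ℕ) :
    ((∑ i, ν i : ℕ) : ℝ) + 1 ≤ ∏ i, ((ν i : ℝ) + 1) := by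
  have h : ∀ s : Finset (Fin r), ∑ i ∈ s, ν i + 1 ≤ ∏ i ∈ s, (ν i + 1) := by
    intro s
    induction s using Finset.induction_on with
    | empty => simp
    | insert k s hk ih =>
      rw [Finset.sum_insert hk, Finset.prod_insert hk]
      nlinarith [Nat.zero_le (ν k * ∑ i ∈ s, ν i)]
  exact_mod_cast h Finset.univ

lemma isDivisorLike_prod :
    IsDivisorLike (fun n : Fin r → ℕ => (divisorCount (∏ i, n i) : ℝ))
      fun ν => ((∑ i, ν i : ℕ) : ℝ) + 1 where
  mult := by
    constructor
    · simp [divisorCount]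
    · intro a b hab
      have h : (∏ i, a i).Coprime (∏ i, b i) :=
        Nat.Coprime.prod_left fun i _ => Nat.Coprime.prod_right fun j _ => hab i j
      simp only [Pi.mul_apply, Finset.prod_mul_distrib]
      rw [divisorCount_mul h, Nat.cast_mul]
  pow p hp ν := by
    simp only [powTuple, Finset.prod_pow_eq_pow_sum]
    rw [divisorCount_prime_pow hp, Nat.cast_add, Nat.cast_one]
  nonneg ν := by positivity
  le := sum_add_one_le_prod
  single j k := by simp

lemma lcm_mul_of_coprime {a b : Fin r → ℕ} (hab : ∀ i j, (a i).Coprime (b j)) :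
    Finset.univ.lcm (a * b) = Finset.univ.lcm a * Finset.univ.lcm b := by
  have h : (Finset.univ.lcm a).Coprime (Finset.univ.lcm b) :=
    Nat.Coprime.of_dvd (Finset.lcm_dvd fun i hi => Finset.dvd_prod_of_mem a hi)
      (Finset.lcm_dvd fun i hi => Finset.dvd_prod_of_mem b hi)
      (Nat.Coprime.prod_left fun i _ => Nat.Coprime.prod_right fun j _ => hab i j)
  apply Nat.dvd_antisymm
  · exact Finset.lcm_dvd fun i hi => mul_dvd_mul (Finset.dvd_lcm hi) (Finset.dvd_lcm hi)
  · refine h.mul_dvd_of_dvd_of_dvd ?_ ?_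
    · exact Finset.lcm_dvd fun i hi => (dvd_mul_right _ _).trans (Finset.dvd_lcm hi)
    · exact Finset.lcm_dvd fun i hi => (dvd_mul_left _ _).trans (Finset.dvd_lcm hi)

lemma lcm_powTuple (p : ℕ) (ν : Fin r → ℕ) :
    Finset.univ.lcm (powTuple p ν) = p ^ Finset.univ.sup ν := by
  apply Nat.dvd_antisymm
  · exact Finset.lcm_dvd fun i hi => pow_dvd_pow _ (Finset.le_sup hi)
  · rcases (Finset.univ : Finset (Fin r)).eq_empty_or_nonempty with h | h
    · simp [h]
    · obtain ⟨i, hi, hsup⟩ := Finset.exists_mem_eq_sup _ h ν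
      rw [hsup]
      exact Finset.dvd_lcm (f := powTuple p ν) hi

lemma isDivisorLike_lcm :
    IsDivisorLike (fun n : Fin r → ℕ => (divisorCount (Finset.univ.lcm n) : ℝ))
      fun ν => ((Finset.univ.sup ν : ℕ) : ℝ) + 1 where
  mult := by
    constructor
    · have h : Finset.univ.lcm (1 : Fin r → ℕ) = 1 :=
        Nat.dvd_one.1 (Finset.lcm_dvd fun i _ => dvd_rfl)
      simp [h, divisorCount]
    · intro a b hab
      have h : (Finset.univ.lcm a).Coprime (Finset.univ.lcm b) :=
        Nat.Coprime.of_dvd (Finset.lcm_dvd fun i hi => Finset.dvd_prod_of_mem a hi)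
          (Finset.lcm_dvd fun i hi => Finset.dvd_prod_of_mem b hi)
          (Nat.Coprime.prod_left fun i _ => Nat.Coprime.prod_right fun j _ => hab i j)
      simp only [lcm_mul_of_coprime hab]
      rw [divisorCount_mul h, Nat.cast_mul]
  pow p hp ν := by
    rw [lcm_powTuple p, divisorCount_prime_pow hp, Nat.cast_add, Nat.cast_one]
  nonneg ν := by positivity
  le ν := by
    refine le_trans ?_ (sum_add_one_le_prod ν)
    have h : Finset.univ.sup ν ≤ ∑ i, ν i :=
      Finset.sup_le fun i hi => Finset.single_le_sum (f := ν) (fun _ _ => Nat.zero_le _) hi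
    have h' : ((Finset.univ.sup ν : ℕ) : ℝ) ≤ ((∑ i, ν i : ℕ) : ℝ) := by exact_mod_cast h
    linarith
  single j k := by
    have h : Finset.univ.sup (Pi.single j k : Fin r → ℕ) = k := by
      apply le_antisymm
      · refine Finset.sup_le fun i _ => ?_
        rcases eq_or_ne i j with rfl | h
        · simp
        · simp [Pi.single_eq_of_ne h]
      · have := Finset.le_sup (f := (Pi.single j k : Fin r → ℕ)) (Finset.mem_univ j)
        simpa using this
    rw [h]

/-- The coefficient is linear in `ν`: weighting by `ν j` changes just one of the `r` geometric
factors, from `1 / (1 - t)` to `t / (1 - t) ^ 2`. -/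
lemma tsum_sum_add_one_mul_pow {t : ℝ} (h0 : 0 ≤ t) (h1 : t < 1) :
    ∑' ν : Fin r → ℕ, (((∑ i, ν i : ℕ) : ℝ) + 1) * t ^ ∑ i, ν i =
      (1 + r * (t / (1 - t))) * ((1 - t)⁻¹) ^ r := by
  have ht : ‖t‖ < 1 := by rwa [Real.norm_of_nonneg h0]
  have hg : Summable fun k => ‖t ^ k‖ := (summable_norm_geometric_of_norm_lt_one ht)
  have hk : Summable fun k : ℕ => ‖(k : ℝ) * t ^ k‖ := by
    simpa using (summable_pow_mul_geometric_of_norm_lt_one 1 ht).norm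
  obtain ⟨hs1, he1⟩ := summable_norm_prod_and_tsum_prod (fun (_ : Fin r) k => t ^ k) fun _ => hg
  have key : ∀ j : Fin r, HasSum (fun ν : Fin r → ℕ => (ν j : ℝ) * ∏ i, t ^ ν i)
      (t / (1 - t) * ((1 - t)⁻¹) ^ r) := by
    intro j
    obtain ⟨hs, he⟩ := summable_norm_prod_and_tsum_prod
      (fun (i : Fin r) k => (if i = j then (k : ℝ) else 1) * t ^ k) (fun i => by
        split_ifs
        · exact hk
        · simpa using hg)
    have h2 : ∀ ν : Fin r → ℕ, ∏ i, (if i = j then (ν i : ℝ) else 1) * t ^ ν i =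
        ν j * ∏ i, t ^ ν i := by
      intro ν
      rw [Finset.prod_mul_distrib, Finset.prod_ite_eq', if_pos (Finset.mem_univ j)]
    have h3 : ∀ i : Fin r, ∑' k : ℕ, (if i = j then (k : ℝ) else 1) * t ^ k =
        (if i = j then t / (1 - t) else 1) * (1 - t)⁻¹ := by
      intro i
      split_ifs
      · rw [tsum_coe_mul_geometric_of_norm_lt_one ht, pow_two, ← div_div, div_eq_mul_inv]
      · simp only [one_mul]
        exact tsum_geometric_of_lt_one h0 h1
    simp only [h2, h3] at hs he
    rw [Finset.prod_mul_distrib, Finset.prod_ite_eq', if_pos (Finset.mem_univ j),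
      Finset.prod_const, Finset.card_univ, Fintype.card_fin] at he
    rw [← he]
    exact hs.of_norm.hasSum
  have h4 := (hasSum_sum fun j (_ : j ∈ Finset.univ) => key j).add hs1.of_norm.hasSum
  rw [he1] at h4
  simp only [tsum_geometric_of_lt_one h0 h1, Finset.sum_const, Finset.prod_const,
    Finset.card_univ, Fintype.card_fin, nsmul_eq_mul] at h4
  have h5 : ∀ ν : Fin r → ℕ, (((∑ i, ν i : ℕ) : ℝ) + 1) * t ^ ∑ i, ν i =
      ∑ j, (ν j : ℝ) * ∏ i, t ^ ν i + ∏ i, t ^ ν i := by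
    intro ν
    rw [← Finset.sum_mul, Finset.prod_pow_eq_pow_sum]
    push_cast
    ring
  simp only [h5]
  rw [h4.tsum_eq]
  ring

/-- With `t = 1 / p` this is `(1 - t) ^ r * (1 + r * t / (1 - t)) = (1 - t) ^ (r - 1) * (1 + (r - 1)
* t)`. -/
lemma eulerFactorP_eq (hr : 1 ≤ r) {p : ℕ} (hp : p.Prime) :
    eulerFactorP r p = (1 - 1 / (p : ℝ)) ^ (2 * r) *
      ∑' ν : Fin r → ℕ, (((∑ i, ν i : ℕ) : ℝ) + 1) * (1 / p : ℝ) ^ ∑ i, ν i := by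
  have h1 : (1 / p : ℝ) < 1 := by
    rw [div_lt_one (by exact_mod_cast hp.pos)]
    exact_mod_cast hp.one_lt
  rw [tsum_sum_add_one_mul_pow (by positivity) h1, eulerFactorP, div_eq_mul_one_div ((r : ℝ) - 1)]
  generalize (1 / p : ℝ) = t at h1
  have h2 : 1 - t ≠ 0 := (sub_pos.2 h1).ne'
  obtain ⟨k, rfl⟩ : ∃ k, r = k + 1 := ⟨r - 1, by lia⟩
  have h3 : (1 - t) ^ (2 * (k + 1)) = (1 - t) ^ k * (1 - t) * (1 - t) ^ (k + 1) := by ring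
  rw [Nat.add_sub_cancel, h3, inv_pow]
  field_simp
  push_cast
  ring

lemma maxTerm_eq (p : ℕ) (ν : Fin r → ℕ) :
    maxTerm r p ν = (((Finset.univ.sup ν : ℕ) : ℝ) + 1) * (1 / p : ℝ) ^ ∑ i, ν i := by
  rw [maxTerm, one_div, inv_pow, div_eq_mul_inv]

end Examples

theorem mainTheorem4 (r : ℕ) (hr : 2 ≤ r) :
    ∃ P Q : Polynomial ℝ,
      P.natDegree = r ∧ Q.natDegree = r ∧
      HasProd (fun p : Nat.Primes => eulerFactorP r p) P.leadingCoeff ∧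
      (∀ p : Nat.Primes, Summable (maxTerm r p)) ∧
      HasProd (fun p : Nat.Primes => eulerFactorQ r p) Q.leadingCoeff ∧
      ∀ θ : ℝ, IsDivisorExponent θ → ∀ ε : ℝ, 0 < ε →
        ((fun x : ℝ => divisorSumProd r x - x ^ r * P.eval (Real.log x))
          =O[atTop] fun x : ℝ => x ^ ((r : ℝ) - 1 + θ + ε)) ∧
        ((fun x : ℝ => divisorSumLcm r x - x ^ r * Q.eval (Real.log x))
          =O[atTop] fun x : ℝ => x ^ ((r : ℝ) - 1 + θ + ε)) := by
  have : NeZero r := ⟨by lia⟩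
  have hP := isDivisorLike_prod (r := r)
  have hQ := isDivisorLike_lcm (r := r)
  refine ⟨mainPoly _, mainPoly _, natDegree_mainPoly hP, natDegree_mainPoly hQ, ?_, ?_, ?_,
    fun θ hθ ε hε => ⟨hP.isBigO_sum_sub (by lia) hθ hε, hQ.isBigO_sum_sub (by lia) hθ hε⟩⟩
  · rw [leadingCoeff_mainPoly hP]
    have h : ∀ p : Nat.Primes, _ := fun p => eulerFactorP_eq (r := r) (by lia) p.2
    simpa only [h] using hP.hasProd
  · intro p
    have h1 : (1 / (p : ℕ) : ℝ) < 1 := by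
      rw [div_lt_one (by exact_mod_cast p.2.pos)]
      exact_mod_cast p.2.one_lt
    exact (hQ.summable_geometric (by positivity) h1).congr fun ν => (maxTerm_eq p ν).symm
  · rw [leadingCoeff_mainPoly hQ]
    simpa only [eulerFactorQ, maxTerm_eq] using hQ.hasProd
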